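/- Let $q>2$ be a prime power and let $\mathcal{C}\subseteq\mathbb{F}_{q^2}^n$ be a linear code of dimension $k$, with Hermitian dual $\mathcal{C}^{\perp_{\rm H}}=\{\mathbf{x}\in\mathbb{F}_{q^2}^n : \sum_{j} x_j c_j^q=0 \text{ for all } \mathbf{c}\in\mathcal{C}\}$ and Hermitian hull $\mathcal{C}\cap\mathcal{C}^{\perp_{\rm H}}$ of dimension $\ell$. For a linear code $\mathcal{D}$ let ${\rm wt}(\mathcal{D})$ be the least Hamming weight of a nonzero codeword. An $[\![n,\kappa,\delta;c]\!]_q$ code (entanglement-assisted quantum code) is the subspace of all states $(U\otimes I_B)\bigl(|\varphi\rangle\otimes|0\rangle^{\otimes(n-\kappa-c)}\otimes|\Psi^+\rangle_{AB}^{\otimes c}\bigr)$, where $|\varphi\rangle\in(\mathbb{C}^q)^{\otimes\kappa}$, $U$ is a fixed unitary on Alice's $n$ qudits and $|\Psi^+\rangle_{AB}$ is a maximally entangled pair of qudits shared by Alice and Bob, whose minimum distance is $\delta$. Here, with $P$ the orthogonal projection onto the code, an error $A$ on Alice's qudits is detected if $P(A\otimes I_B)P=\mu P$ for some $\mu\in\mathbb{C}$,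 and purely detected if this holds with $\mu={\rm tr}(A)/q^n$; the minimum distance is the least number of Alice's qudits supporting an error that is not detected (not purely detected if $\kappa=0$), or $n+1$ if there is none. The code is pure to distance $d$ if all errors on fewer than $d$ of Alice's qudits are purely detected. An $[\![n,\kappa,\delta;c]\!]_q$ code is obtained from $\mathcal{C}$ by the Hermitian construction if $c=k-\ell$, $\kappa=n-2k+c$, and all its states are fixed by operators $z_{\mathbf{x}}\,E_{\mathbf{x}}\otimes F_{\mathbf{x}}$, one for each $\mathbf{x}\in\mathcal{C}$, where $z_{\mathbf{x}}\in\mathbb{C}$, $F_{\mathbf{x}}$ is a Pauli operator on Bob's $c$ qudits, and $E_{\mathbf{x}}=X(\mathbf{a})Z(\mathbf{b})$ is the Pauli operator on Alice's $n$ qudits with $\mathbf{x}=\beta_0\mathbf{a}+\beta_1\mathbf{b}$, for some basis $(\beta_0,\beta_1)$ of $\mathbb{F}_{q^2}$ over $\mathbb{F}_q$ (the Pauli operators being $X(\mathbf{a})Z(\mathbf{b})|\mathbf{y}\rangle=\chi(\mathbf{b}\cdot\mathbf{y})|\mathbf{y}+\mathbf{a}\rangle$ for some nontrivial additive character $\chi$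 of $\mathbb{F}_q$). It is called pure if $\delta={\rm wt}(\mathcal{C}^{\perp_{\rm H}})$. **Theorem (More Entanglement).** Let $\mathcal{Q}$ be a pure $[\![n,\kappa,\delta;c]\!]_q$ code obtained from $\mathcal{C}$ by the Hermitian construction. Then for each $i\in\{1,\dots,\ell\}$ there is an $[\![n,\kappa+i,\delta;c+i]\!]_q$ code $\mathcal{Q}'$ that is pure to distance $\delta$. Moreover, $\mathcal{Q}'$ can be chosen to be obtained by the Hermitian construction from a linear code $\mathcal{C}'\subseteq\mathbb{F}_{q^2}^n$ with ${\rm wt}(\mathcal{C}'^{\perp_{\rm H}})=\delta$. -/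

import Mathlib

open scoped Matrix Kronecker

namespace EAQ

/-! Classical codes of length `n` over `E = 𝔽_{q²}`, where `K = 𝔽_q` and `q = Fintype.card K`. -/

section Classical

variable (K : Type*) {E : Type*} [Field K] [Fintype K] [Field E] {n : ℕ}

/-- The Hermitian dual `{x | ∑ xᵢ cᵢ^q = 0 for all c ∈ C}`, with `q = |K|`. -/
def hermitianDual (C : Submodule E (Fin n → E)) : Submodule E (Fin n → E) where
  carrier := {x | ∀ c ∈ C, ∑ i, x i * c i ^ Fintype.card K = 0}
  zero_mem' := by
    intro c _
    simp
  add_mem' := by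
    intro x y hx hy c hc
    simp only [Pi.add_apply, add_mul, Finset.sum_add_distrib, hx c hc, hy c hc, add_zero]
  smul_mem' := by
    intro r x hx c hc
    simp only [Pi.smul_apply, smul_eq_mul, mul_assoc, ← Finset.mul_sum, hx c hc, mul_zero]

/-- The Hermitian hull `C ∩ C^{⊥_H}`. -/
def hermitianHull (C : Submodule E (Fin n → E)) : Submodule E (Fin n → E) :=
  C ⊓ hermitianDual K C

end Classical

/-- `d` is the minimum of the Hamming weights of the nonzero vectors of `C`. -/
def IsMinWeight {E : Type*} [Field E] [DecidableEq E] {n : ℕ}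
    (C : Submodule E (Fin n → E)) (d : ℕ) : Prop :=
  IsLeast {w : ℕ | ∃ v ∈ C, v ≠ 0 ∧ hammingNorm v = w} d

/-! Entanglement-assisted quantum codes. A qudit is `ℂ^q` with computational basis labelled by `K`,
so `n` qudits have state space `(Fin n → K) → ℂ`. Alice's `n` qudits and Bob's `c` qudits
(his halves of the maximally entangled pairs) have state space
`(Fin n → K) × (Fin c → K) → ℂ`, and `A ⊗ₖ B` lets `A` act on Alice's side and `B` on Bob's. -/

section Quantum

variable {K : Type*} [Field K] [Fintype K] [DecidableEq K] {n c : ℕ}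

/-- The state `|φ⟩ ⊗ |0⟩^{⊗ a} ⊗ |Ψ⁺⟩_{AB}^{⊗ c}` of `κ` logical qudits, `a` ancillas and `c`
maximally entangled pairs, `|Ψ⁺⟩^{⊗ c} = q^{-c/2} ∑_b |b⟩_A |b⟩_B`. The first component of the index
is Alice's (`κ + a + c` qudits), the second one is Bob's. -/
noncomputable def inputState (κ a c : ℕ) (φ : (Fin κ → K) → ℂ) :
    ((Fin κ → K) × (Fin a → K) × (Fin c → K)) × (Fin c → K) → ℂ :=
  fun s => φ s.1.1 * (if s.1.2.1 = 0 then 1 else 0) *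
    (if s.1.2.2 = s.2 then ((Real.sqrt ((Fintype.card K : ℝ) ^ c) : ℝ) : ℂ)⁻¹ else 0)

/-- `Q` consists of the encoded states `(U ⊗ I_B)(|φ⟩ ⊗ |0⟩^{⊗ (n-κ-c)} ⊗ |Ψ⁺⟩_{AB}^{⊗ c})`
for some encoding unitary `U` on Alice's `n` qudits. -/
def IsEncoded (Q : Submodule ℂ ((Fin n → K) × (Fin c → K) → ℂ)) (κ : ℕ) : Prop :=
  ∃ a : ℕ, κ + a + c = n ∧
    ∃ U : Matrix (Fin n → K) ((Fin κ → K) × (Fin a → K) × (Fin c → K)) ℂ,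
      Uᴴ * U = 1 ∧ U * Uᴴ = 1 ∧
      ∀ v, v ∈ Q ↔ ∃ φ : (Fin κ → K) → ℂ,
        v = (U ⊗ₖ (1 : Matrix (Fin c → K) (Fin c → K) ℂ)) *ᵥ inputState κ a c φ

/-- The operator `A` on `n` qudits acts only on the qudits in `S`, i.e. `A = M_S ⊗ I`. -/
def SupportedOn (S : Finset (Fin n)) (A : Matrix (Fin n → K) (Fin n → K) ℂ) : Prop :=
  ∃ M : Matrix (S → K) (S → K) ℂ, ∀ x y : Fin n → K,
    A x y = if ∀ i, i ∉ S → x i = y i then M (fun i => x i) (fun i => y i) else 0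

/-- On the code, the error `A` (on Alice's qudits) has `P (A ⊗ I_B) P = μ P`, where `P` is the
orthogonal projection onto `Q`. -/
def ActsAs (Q : Submodule ℂ ((Fin n → K) × (Fin c → K) → ℂ))
    (A : Matrix (Fin n → K) (Fin n → K) ℂ) (μ : ℂ) : Prop :=
  ∀ v ∈ Q, ∀ w ∈ Q,
    star v ⬝ᵥ ((A ⊗ₖ (1 : Matrix (Fin c → K) (Fin c → K) ℂ)) *ᵥ w) = μ * (star v ⬝ᵥ w)

/-- The Knill-Laflamme condition: the error `A` is detected by `Q`. -/
def Detects (Q : Submodule ℂ ((Fin n → K) × (Fin c → K) → ℂ))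
    (A : Matrix (Fin n → K) (Fin n → K) ℂ) : Prop :=
  ∃ μ : ℂ, ActsAs Q A μ

/-- `A` is purely detected: `P (A ⊗ I_B) P = (tr A / q^n) P`. Thus for traceless `A`, in
particular for every non-identity Pauli error, `P (A ⊗ I_B) P = 0`. -/
def DetectsPurely (Q : Submodule ℂ ((Fin n → K) × (Fin c → K) → ℂ))
    (A : Matrix (Fin n → K) (Fin n → K) ℂ) : Prop :=
  ActsAs Q A (A.trace / (Fintype.card K : ℂ) ^ n)

/-- `Q` is pure to distance `d`: every error on fewer than `d` of Alice's qudits is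
purely detected. -/
def IsPureTo (Q : Submodule ℂ ((Fin n → K) × (Fin c → K) → ℂ)) (d : ℕ) : Prop :=
  ∀ S : Finset (Fin n), S.card < d → ∀ A : Matrix (Fin n → K) (Fin n → K) ℂ,
    SupportedOn S A → DetectsPurely Q A

/-- `δ` is the minimum distance of the code `Q` with `κ` logical qudits: the least number of
Alice's qudits on which some undetected error acts. A code with `κ = 0` has to be pure, so there an
error counts as soon as it is not purely detected. The value is `n + 1` if there is no such
error. -/
def IsMinDistance (Q : Submodule ℂ ((Fin n → K) × (Fin c → K) → ℂ)) (κ δ : ℕ) : Prop :=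
  IsLeast ({d : ℕ | ∃ S : Finset (Fin n), S.card = d ∧ ∃ A : Matrix (Fin n → K) (Fin n → K) ℂ,
    SupportedOn S A ∧ (¬ Detects Q A ∨ (κ = 0 ∧ ¬ DetectsPurely Q A))} ∪ {n + 1}) δ

/-- `Q` is an `[[n, κ, δ; c]]_q` code, `q = |K|`. -/
structure IsEAQECC (Q : Submodule ℂ ((Fin n → K) × (Fin c → K) → ℂ)) (κ δ : ℕ) : Prop where
  encoded : IsEncoded Q κ
  distance : IsMinDistance Q κ δ

/-- The Pauli (Weyl) operator `X(a) Z(b) : |y⟩ ↦ χ(b · y) |y + a⟩` on `m` qudits, with respect to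
an additive character `χ` of `K`. -/
def pauli {m : ℕ} (χ : AddChar K ℂ) (a b : Fin m → K) : Matrix (Fin m → K) (Fin m → K) ℂ :=
  Matrix.of fun x y => if x = y + a then χ (∑ i, b i * y i) else 0

variable {E : Type*} [Field E] [Algebra K E]

/-- The Pauli operator of `x ∈ E^n`: writing `x = a β₀ + b β₁` in a `K`-basis of `E`, it
is `X(a) Z(b)`. -/
noncomputable def pauliOf (χ : AddChar K ℂ) (β : Module.Basis (Fin 2) K E) (x : Fin n → E) :
    Matrix (Fin n → K) (Fin n → K) ℂ :=
  pauli χ (fun i => β.repr (x i) 0) (fun i => β.repr (x i) 1)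

/-- `Q` arises from the linear code `C ⊆ E^n`, `k = dim C`, by the Hermitian construction: with
`c = k - dim Hull(C)` maximally entangled pairs and `κ = n - 2k + c` logical qudits, the (in
general non-commuting) Pauli operators of the codewords of `C` are completed on Bob's side, up to
scalars, by Pauli operators so that all the resulting operators stabilize `Q`. Together
with `dim Q = q^κ = q^{n+c} / |C|` (part of `IsEAQECC`) this says that `Q` is
the whole joint eigenspace. -/
structure IsHermitianConstruction (C : Submodule E (Fin n → E))
    (Q : Submodule ℂ ((Fin n → K) × (Fin c → K) → ℂ)) (κ : ℕ) : Prop where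
  ebits : c + Module.finrank E (hermitianHull K C) = Module.finrank E C
  logical : κ + 2 * Module.finrank E C = n + c
  stabilized : ∃ (χ : AddChar K ℂ) (β : Module.Basis (Fin 2) K E), χ ≠ 1 ∧
    ∀ x ∈ C, ∃ (z : ℂ) (u v : Fin c → K), ∀ w ∈ Q,
      (z • (pauliOf χ β x ⊗ₖ pauli χ u v)) *ᵥ w = w

end Quantum

end EAQ

namespace EAQ

/-! ### Shrinking the Hermitian hull by coordinate scaling -/

section HermitianHull

variable {K E : Type*} [Field E] [Fintype K] {n : ℕ}

/-! Multiply one coordinate of `C` by `g` with norm `g ^ (q + 1) ≠ 1`, which exists because `q > 2`.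
The dimension is unchanged, and the dual is only rescaled, so its weights are unchanged. If some
hull word is nonzero at that coordinate, the hull shrinks to its words vanishing there
(`hermitianHull_map_update`), losing exactly one dimension. After `i` rounds the relations `c + ℓ =
k` and `κ + 2k = n + c` hold with `c + i`, `κ + i`, `ℓ - i`. The last coordinate is chosen so that
some dual word of weight `δ` lies outside the new code.

Such a code yields a quantum code (`exists_hermitianConstruction`). The symplectic form on `C`,
whose radical is the hull, is pulled back along a surjection `θ` onto `K^c × K^c`
(`exists_symplectic_reduction`). Placing the swapped image of `x` on Bob's side cancels the
commutation phases, so after normalizing scalars the Pauli operators form a commuting group; its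
fixed space has dimension `q^κ` by a trace count. Surjectivity of `θ` makes Bob's share maximally
mixed, which yields the encoding unitary. Nonzero words of weight below `δ` are not in the dual, so
their Pauli operators fail to commute with some stabilizer: purity. The dual word outside the code
gives an undetected error of weight `δ`. -/

theorem mem_hermitianDual {C : Submodule E (Fin n → E)} {x : Fin n → E} :
    x ∈ hermitianDual K C ↔ ∀ c ∈ C, ∑ i, x i * c i ^ Fintype.card K = 0 := Iff.rfl

theorem mem_hermitianDual_map {C : Submodule E (Fin n → E)} (a x : Fin n → E) :
    x ∈ hermitianDual K (C.map (LinearMap.mulLeft E a)) ↔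
      x * a ^ Fintype.card K ∈ hermitianDual K C := by
  simp [mem_hermitianDual, mul_pow, mul_assoc]

theorem hammingNorm_mul_of_ne_zero [DecidableEq E] (x : Fin n → E) {a : Fin n → E}
    (ha : ∀ i, a i ≠ 0) : hammingNorm (x * a) = hammingNorm x := by
  simp [hammingNorm, ha]

/-- The dual of the scaled code is the old dual divided by `a ^ q`, and scaling by nonzero entries
preserves Hamming weight. -/
theorem isMinWeight_hermitianDual_map [DecidableEq E] {C : Submodule E (Fin n → E)} {δ : ℕ}
    {a : Fin n → E} (ha : ∀ i, a i ≠ 0) (h : IsMinWeight (hermitianDual K C) δ) :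
    IsMinWeight (hermitianDual K (C.map (LinearMap.mulLeft E a))) δ := by
  have ha' : ∀ i, (a ^ Fintype.card K) i ≠ 0 := fun i => pow_ne_zero _ (ha i)
  have hb : ∀ i, (a ^ Fintype.card K)⁻¹ i ≠ 0 := fun i => inv_ne_zero (ha' i)
  have hinv : (a ^ Fintype.card K)⁻¹ * a ^ Fintype.card K = 1 :=
    funext fun i => inv_mul_cancel₀ (ha' i)
  obtain ⟨⟨v, hv, hv0, hvw⟩, hmin⟩ := h
  refine ⟨⟨v * (a ^ Fintype.card K)⁻¹, ?_, ?_, ?_⟩, ?_⟩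
  · rwa [mem_hermitianDual_map, mul_assoc, hinv, mul_one]
  · rwa [← hammingNorm_ne_zero_iff, hammingNorm_mul_of_ne_zero _ hb, hammingNorm_ne_zero_iff]
  · rwa [hammingNorm_mul_of_ne_zero _ hb]
  · rintro w ⟨u, hu, hu0, rfl⟩
    refine hmin ⟨u * a ^ Fintype.card K, (mem_hermitianDual_map a u).1 hu, ?_,
      hammingNorm_mul_of_ne_zero _ ha'⟩
    rwa [← hammingNorm_ne_zero_iff, hammingNorm_mul_of_ne_zero _ ha', hammingNorm_ne_zero_iff]

variable [Field K] [Algebra K E]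

theorem add_pow_card (x y : E) :
    (x + y) ^ Fintype.card K = x ^ Fintype.card K + y ^ Fintype.card K := by
  simpa using map_add (FiniteField.frobeniusAlgHom K E) x y

theorem sum_pow_card {ι : Type*} (s : Finset ι) (f : ι → E) :
    (∑ i ∈ s, f i) ^ Fintype.card K = ∑ i ∈ s, f i ^ Fintype.card K := by
  exact map_sum (FiniteField.frobeniusAlgHom K E) f s

theorem frobeniusAlgHom_sq (hE : Module.finrank K E = 2) :
    FiniteField.frobeniusAlgHom K E ^ 2 = 1 := by
  have : Module.Finite K E := Module.finite_of_finrank_pos (by omega)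
  have : Finite E := Module.finite_of_finite K
  rw [← hE, ← FiniteField.orderOf_frobeniusAlgHom K E, pow_orderOf_eq_one]

theorem pow_card_pow_card (hE : Module.finrank K E = 2) (x : E) :
    (x ^ Fintype.card K) ^ Fintype.card K = x := by
  simpa [pow_two] using DFunLike.congr_fun (frobeniusAlgHom_sq hE) x

theorem exists_pow_card_ne_self (hE : Module.finrank K E = 2) :
    ∃ e : E, e ^ Fintype.card K ≠ e := by
  have : Module.Finite K E := Module.finite_of_finrank_pos (by omega)
  have : Finite E := Module.finite_of_finite K
  by_contra! h
  have h1 : FiniteField.frobeniusAlgHom K E = 1 := by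
    ext x
    simpa using h x
  have h2 := FiniteField.orderOf_frobeniusAlgHom K E
  rw [h1, orderOf_one] at h2
  omega

/-- A generator of `Eˣ` has order `q² - 1`, which exceeds `q + 1` exactly when `q > 2`. -/
theorem exists_norm_ne_one (hE : Module.finrank K E = 2) (hq : 2 < Fintype.card K) :
    ∃ g : E, g ≠ 0 ∧ g * g ^ Fintype.card K ≠ 1 := by
  have : Module.Finite K E := Module.finite_of_finrank_pos (by omega)
  have : Finite E := Module.finite_of_finite K
  obtain ⟨u, hu⟩ := IsCyclic.exists_generator (α := Eˣ)
  refine ⟨u, u.ne_zero, fun h => ?_⟩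
  have h1 : u ^ (Fintype.card K + 1) = 1 := by
    ext
    simpa [pow_succ'] using h
  have h2 := Nat.le_of_dvd (Nat.succ_pos _) (orderOf_dvd_of_pow_eq_one h1)
  rw [orderOf_eq_card_of_forall_mem_zpowers hu, Nat.card_units,
    Module.natCard_eq_pow_finrank (K := K), hE, Nat.card_eq_fintype_card] at h2
  have h3 : 3 * Fintype.card K ≤ Fintype.card K ^ 2 := by nlinarith
  omega

theorem hermitian_comm (hE : Module.finrank K E = 2) (x y : Fin n → E) :
    (∑ i, x i * y i ^ Fintype.card K) ^ Fintype.card K = ∑ i, y i * x i ^ Fintype.card K := by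
  simp only [sum_pow_card, mul_pow, pow_card_pow_card hE, mul_comm]

theorem hermitian_eq_zero_comm (hE : Module.finrank K E = 2) {x y : Fin n → E}
    (h : ∑ i, x i * y i ^ Fintype.card K = 0) : ∑ i, y i * x i ^ Fintype.card K = 0 := by
  rw [← hermitian_comm hE, h, zero_pow Fintype.card_ne_zero]

/-- Scaling changes the pairing of `u` and `y` by `(g ^ (q + 1) - 1) * u j * y j ^ q`. For `y` in
the old hull and the scaled `u` in the new one, both pairings vanish, so `u j = 0`. Words vanishing
at `j` are not affected by the scaling. -/
theorem hermitianHull_map_update (hE : Module.finrank K E = 2) {C : Submodule E (Fin n → E)}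
    {g : E} (hg : g * g ^ Fintype.card K ≠ 1) {j : Fin n} {y : Fin n → E}
    (hy : y ∈ hermitianHull K C) (hyj : y j ≠ 0) :
    hermitianHull K (C.map (LinearMap.mulLeft E (Function.update 1 j g))) =
      hermitianHull K C ⊓ LinearMap.ker (LinearMap.proj j) := by
  have fix : ∀ x : Fin n → E, x j = 0 → Function.update (1 : Fin n → E) j g * x = x := by
    intro x hx
    ext i
    by_cases hi : i = j
    · subst hi; simp [hx]
    · simp [hi]
  have fix' : ∀ x : Fin n → E, x j = 0 →
      x * (Function.update (1 : Fin n → E) j g) ^ Fintype.card K = x := by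
    intro x hx
    ext i
    by_cases hi : i = j
    · subst hi; simp [hx]
    · simp [hi]
  ext x
  constructor
  · rintro ⟨⟨u, hu, rfl⟩, hx⟩
    rw [SetLike.mem_coe, mem_hermitianDual_map] at hx
    have hu0 : u j = 0 := by
      have h1 := hx y hy.1
      have h2 : ∑ i, u i * y i ^ Fintype.card K = 0 := hermitian_eq_zero_comm hE (hy.2 u hu)
      have h3 : ∑ i, ((LinearMap.mulLeft E (Function.update (1 : Fin n → E) j g) u) *
            Function.update (1 : Fin n → E) j g ^ Fintype.card K) i * y i ^ Fintype.card K -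
          ∑ i, u i * y i ^ Fintype.card K =
          (g * g ^ Fintype.card K - 1) * (u j * y j ^ Fintype.card K) := by
        rw [← Finset.sum_sub_distrib, Finset.sum_eq_single j]
        · simp; ring
        · intro i _ hi
          simp [hi]
        · simp
      rw [h1, h2, sub_zero, eq_comm, mul_eq_zero, mul_eq_zero] at h3
      rcases h3 with h3 | h3 | h3
      · exact absurd (sub_eq_zero.1 h3) hg
      · exact h3
      · exact absurd h3 (pow_ne_zero _ hyj)
    rw [LinearMap.mulLeft_apply, fix u hu0] at hx ⊢
    rw [fix' u hu0] at hx
    exact ⟨⟨hu, hx⟩, hu0⟩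
  · rintro ⟨⟨hx, hx'⟩, hx0⟩
    refine ⟨⟨x, hx, fix x hx0⟩, ?_⟩
    rw [SetLike.mem_coe, mem_hermitianDual_map, fix' x hx0]
    exact hx'

theorem finrank_inf_ker_proj {H : Submodule E (Fin n → E)} {j : Fin n} {y : Fin n → E}
    (hy : y ∈ H) (hyj : y j ≠ 0) :
    Module.finrank E (H ⊓ LinearMap.ker (LinearMap.proj j) : Submodule E (Fin n → E)) + 1 =
      Module.finrank E H := by
  have hf : (LinearMap.proj j : (Fin n → E) →ₗ[E] E).domRestrict H ≠ 0 := fun h =>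
    hyj (by simpa using LinearMap.congr_fun h ⟨y, hy⟩)
  rw [← Module.Dual.finrank_ker_add_one_of_ne_zero (f := LinearMap.domRestrict _ H) hf,
    LinearMap.ker_domRestrict, ← Submodule.finrank_map_subtype_eq, Submodule.map_comap_subtype]

theorem exists_hull_finrank_pred [DecidableEq E] (hE : Module.finrank K E = 2)
    (hq : 2 < Fintype.card K) {C : Submodule E (Fin n → E)} {δ : ℕ}
    (hδ : IsMinWeight (hermitianDual K C) δ)
    (hℓ : 0 < Module.finrank E (hermitianHull K C)) :
    ∃ C' : Submodule E (Fin n → E), Module.finrank E C' = Module.finrank E C ∧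
      Module.finrank E (hermitianHull K C') + 1 = Module.finrank E (hermitianHull K C) ∧
      IsMinWeight (hermitianDual K C') δ ∧
      ∃ x ∈ hermitianDual K C', x ∉ C' ∧ hammingNorm x = δ := by
  obtain ⟨g, hg0, hg⟩ := exists_norm_ne_one (K := K) (E := E) hE hq
  obtain ⟨x, hx, hx0, hxδ⟩ := hδ.1
  -- If the minimum weight dual word `x` lies in `C`, it is itself a hull word, and `j` is taken in
  -- its support so that the scaling moves it out of the code.
  obtain ⟨j, y, hy, hyj, hxj⟩ : ∃ (j : Fin n) (y : Fin n → E), y ∈ hermitianHull K C ∧ y j ≠ 0 ∧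
      (x ∈ C → x j ≠ 0) := by
    by_cases hxC : x ∈ C
    · obtain ⟨j, hj⟩ := Function.ne_iff.1 hx0
      exact ⟨j, x, ⟨hxC, hx⟩, hj, fun _ => hj⟩
    · obtain ⟨y, hy, hy0⟩ := Submodule.exists_mem_ne_zero_of_ne_bot
        (Submodule.one_le_finrank_iff.1 hℓ)
      obtain ⟨j, hj⟩ := Function.ne_iff.1 hy0
      exact ⟨j, y, hy, hj, fun h => absurd h hxC⟩
  set a : Fin n → E := Function.update 1 j g with ha_def
  have ha : ∀ i, a i ≠ 0 := by
    intro i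
    by_cases hi : i = j
    · subst hi; simpa [ha_def] using hg0
    · simp [ha_def, hi]
  have ha' : ∀ i, (a ^ Fintype.card K) i ≠ 0 := fun i => pow_ne_zero _ (ha i)
  have hb : ∀ i, (a ^ Fintype.card K)⁻¹ i ≠ 0 := fun i => inv_ne_zero (ha' i)
  have hinv : (a ^ Fintype.card K)⁻¹ * a ^ Fintype.card K = 1 :=
    funext fun i => inv_mul_cancel₀ (ha' i)
  have hhull := hermitianHull_map_update hE hg hy hyj
  have hdual : x * (a ^ Fintype.card K)⁻¹ ∈
      hermitianDual K (C.map (LinearMap.mulLeft E a)) := by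
    rwa [mem_hermitianDual_map, mul_assoc, hinv, mul_one]
  refine ⟨C.map (LinearMap.mulLeft E a), ?_, ?_, isMinWeight_hermitianDual_map ha hδ,
    x * (a ^ Fintype.card K)⁻¹, hdual, ?_, ?_⟩
  · refine ((C.equivMapOfInjective (LinearMap.mulLeft E a) ?_).finrank_eq).symm
    intro u v huv
    ext i
    exact mul_left_cancel₀ (ha i) (congrFun huv i)
  · rw [hhull, finrank_inf_ker_proj hy hyj]
  -- Otherwise the scaled `x` would be a word of the new hull, hence vanish at `j`; then it equals
  -- `x`, which would lie in `C` with `x j = 0`, against the choice of `j`.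
  · intro hmem
    have h : x * (a ^ Fintype.card K)⁻¹ ∈ hermitianHull K (C.map (LinearMap.mulLeft E a)) :=
      ⟨hmem, hdual⟩
    rw [hhull] at h
    obtain ⟨⟨h1, -⟩, h2⟩ := h
    have h3 : x j = 0 := (mul_eq_zero.1 h2).resolve_right (hb j)
    have h4 : x * (a ^ Fintype.card K)⁻¹ = x := by
      ext i
      by_cases hi : i = j
      · subst hi; simp [h3]
      · simp [ha_def, hi]
    rw [h4] at h1
    exact hxj h1 h3
  · rw [hammingNorm_mul_of_ne_zero _ hb, hxδ]

/-- The count is `i + 1` because the dual word outside the code is produced by a scaling, so at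
least one is needed; the last one supplies it. -/
theorem exists_hull_finrank_sub [DecidableEq E] (hE : Module.finrank K E = 2)
    (hq : 2 < Fintype.card K) {C : Submodule E (Fin n → E)} {δ : ℕ}
    (hδ : IsMinWeight (hermitianDual K C) δ) (i : ℕ)
    (hi : i + 1 ≤ Module.finrank E (hermitianHull K C)) :
    ∃ C' : Submodule E (Fin n → E), Module.finrank E C' = Module.finrank E C ∧
      Module.finrank E (hermitianHull K C') + (i + 1) = Module.finrank E (hermitianHull K C) ∧
      IsMinWeight (hermitianDual K C') δ ∧
      ∃ x ∈ hermitianDual K C', x ∉ C' ∧ hammingNorm x = δ := by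
  induction i with
  | zero => exact exists_hull_finrank_pred hE hq hδ hi
  | succ i ih =>
    obtain ⟨C₁, h1, h2, h3, -⟩ := ih (by omega)
    obtain ⟨C₂, h4, h5, h6, h7⟩ := exists_hull_finrank_pred hE hq h3 (by omega)
    exact ⟨C₂, h4.trans h1, by omega, h6, h7⟩

end HermitianHull

/-! ### Alternating forms modulo their radical -/

section Symplectic

variable {K : Type*} [Field K]

/-- The standard symplectic form on `K^m × K^m`. -/
def symp {m : ℕ} (v w : (Fin m → K) × (Fin m → K)) : K := v.1 ⬝ᵥ w.2 - v.2 ⬝ᵥ w.1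

theorem symp_zero_left {m : ℕ} (w : (Fin m → K) × (Fin m → K)) : symp 0 w = 0 := by
  simp [symp]

theorem eq_zero_of_symp_eq_zero {m : ℕ} {v : (Fin m → K) × (Fin m → K)}
    (h : ∀ w, symp v w = 0) : v = 0 := by
  refine Prod.ext ?_ ?_
  · ext i
    simpa [symp] using h (0, Pi.single i 1)
  · ext i
    simpa [symp] using h (Pi.single i 1, 0)

/-- Induction on dimension: split off a hyperbolic plane spanned by `e`, `f` and recurse on its
orthogonal complement `W`. The zero form is the base case with `m = 0`. -/
theorem exists_surjective_symp_eq {V : Type*} [AddCommGroup V] [Module K V] [Module.Finite K V]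
    (B : V →ₗ[K] V →ₗ[K] K) (hB : B.IsAlt) :
    ∃ (m : ℕ) (θ : V →ₗ[K] (Fin m → K) × (Fin m → K)), Function.Surjective θ ∧
      ∀ x y, B x y = symp (θ x) (θ y) := by
  induction hd : Module.finrank K V using Nat.strong_induction_on generalizing V with
  | _ d ih =>
  by_cases hB0 : B = 0
  · exact ⟨0, 0, fun v => ⟨0, Subsingleton.elim _ _⟩, fun x y => by simp [hB0, symp]⟩
  obtain ⟨e, f', hef'⟩ : ∃ e f, B e f ≠ 0 := by
    by_contra! h
    exact hB0 (LinearMap.ext₂ h)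
  obtain ⟨f, hef⟩ : ∃ f, B e f = 1 := ⟨(B e f')⁻¹ • f', by simp [hef']⟩
  have hfe : B f e = -1 := by rw [← hB.neg, hef]
  let W : Submodule K V := LinearMap.ker (B e) ⊓ LinearMap.ker (B f)
  have hW : Module.finrank K W < d := by
    rw [← hd]
    refine Submodule.finrank_lt fun h => ?_
    have : f ∈ W := h ▸ Submodule.mem_top
    have h1 : B e f = 0 := this.1
    rw [hef] at h1
    exact one_ne_zero h1
  obtain ⟨m, θ, hθ, hθB⟩ := ih _ hW (B.domRestrict₁₂ W W) (fun x => hB x) rfl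
  -- The projection along the plane: `x = π x - B f x • e + B e x • f`. These two coefficients are
  -- the new coordinates in `Θ`.
  let π : V →ₗ[K] W := LinearMap.codRestrict W
    (LinearMap.id + (B f).smulRight e - (B e).smulRight f) (fun x => by
      constructor
      · simp [hef, hB e]
      · simp [hfe, hB f])
  have hπ : ∀ x, (π x : V) = x + B f x • e - B e x • f := fun x => rfl
  have hW' : ∀ w : W, B e w = 0 ∧ B f w = 0 := fun w => w.2
  let Θ : V →ₗ[K] (Fin (m + 1) → K) × (Fin (m + 1) → K) :=
    { toFun := fun x => (Fin.cons (-B f x) (θ (π x)).1, Fin.cons (B e x) (θ (π x)).2)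
      map_add' := fun x y => by
        refine Prod.ext ?_ ?_ <;> ext i <;> refine Fin.cases ?_ (fun i => ?_) i <;>
          simp only [map_add, Prod.fst_add, Prod.snd_add, Pi.add_apply, Fin.cons_zero,
            Fin.cons_succ, neg_add]
      map_smul' := fun c x => by
        refine Prod.ext ?_ ?_ <;> ext i <;> refine Fin.cases ?_ (fun i => ?_) i <;>
          simp only [map_smul, Prod.smul_fst, Prod.smul_snd, Pi.smul_apply, Fin.cons_zero,
            Fin.cons_succ, smul_neg, RingHom.id_apply] }
  have hΘ : ∀ x, Θ x = (Fin.cons (-B f x) (θ (π x)).1, Fin.cons (B e x) (θ (π x)).2) :=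
    fun x => rfl
  refine ⟨m + 1, Θ, ?_, ?_⟩
  · rintro ⟨p, r⟩
    obtain ⟨w, hw⟩ := hθ (Fin.tail p, Fin.tail r)
    have h1 : B e (p 0 • e + r 0 • f + w) = r 0 := by simp [hef, hB e, hW']
    have h2 : B f (p 0 • e + r 0 • f + w) = -p 0 := by simp [hfe, hB f, hW']
    have h3 : π (p 0 • e + r 0 • f + w) = w := by
      ext
      rw [hπ, h1, h2]
      module
    refine ⟨p 0 • e + r 0 • f + w, ?_⟩
    rw [hΘ, h1, h2, h3, hw]
    simp
  · intro x y
    have hx := hπ x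
    have hy := hπ y
    have h1 := hθB (π x) (π y)
    rw [LinearMap.domRestrict₁₂_apply, hx, hy] at h1
    have h2 : B x e = - B e x := by rw [hB.neg]
    have h3 : B x f = - B f x := by rw [hB.neg]
    have h4 : symp (Θ x) (Θ y) = -B f x * B e y - B e x * (- B f y) +
        symp (θ (π x)) (θ (π y)) := by
      simp only [hΘ, symp, dotProduct, Fin.sum_univ_succ, Fin.cons_zero, Fin.cons_succ]
      ring
    rw [h4, ← h1]
    simp only [map_add, map_sub, map_smul, LinearMap.add_apply, LinearMap.sub_apply,
      LinearMap.smul_apply, smul_eq_mul, hef, hfe, hB e, hB f, h2, h3]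
    ring

end Symplectic

/-! ### Symplectic and Hermitian orthogonality -/

section Coordinates

variable {K E : Type*} [Field K] [Field E] [Algebra K E] {n : ℕ}

/-- The coordinate vectors `(a, b)` of `x = a β₀ + b β₁`. -/
noncomputable def coords (β : Module.Basis (Fin 2) K E) :
    (Fin n → E) →ₗ[K] (Fin n → K) × (Fin n → K) :=
  (LinearMap.pi fun i => β.coord 0 ∘ₗ LinearMap.proj i).prod
    (LinearMap.pi fun i => β.coord 1 ∘ₗ LinearMap.proj i)

theorem coords_fst (β : Module.Basis (Fin 2) K E) (x : Fin n → E) (i : Fin n) :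
    (coords β x).1 i = β.repr (x i) 0 := rfl

theorem coords_snd (β : Module.Basis (Fin 2) K E) (x : Fin n → E) (i : Fin n) :
    (coords β x).2 i = β.repr (x i) 1 := rfl

theorem coords_apply_eq_zero_iff (β : Module.Basis (Fin 2) K E) (x : Fin n → E) (i : Fin n) :
    ((coords β x).1 i = 0 ∧ (coords β x).2 i = 0) ↔ x i = 0 := by
  rw [coords_fst, coords_snd, ← map_eq_zero_iff β.repr β.repr.injective, Finsupp.ext_iff,
    Fin.forall_fin_two]
  rfl

theorem coords_injective (β : Module.Basis (Fin 2) K E) :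
    Function.Injective (coords (n := n) β) := by
  rw [injective_iff_map_eq_zero]
  intro x hx
  ext i
  exact (coords_apply_eq_zero_iff β x i).1 (by simp [hx])

theorem coords_surjective (β : Module.Basis (Fin 2) K E) :
    Function.Surjective (coords (n := n) β) := by
  rintro ⟨a, b⟩
  refine ⟨fun i => a i • β 0 + b i • β 1, Prod.ext ?_ ?_⟩
  · ext i
    simp [coords_fst]
  · ext i
    simp [coords_snd]

/-- The standard symplectic form in coordinates, as a bilinear form on `E^n`. -/
noncomputable def sympForm (β : Module.Basis (Fin 2) K E) :
    (Fin n → E) →ₗ[K] (Fin n → E) →ₗ[K] K :=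
  LinearMap.mk₂ K (fun x y => symp (coords β x) (coords β y))
    (by intros; simp [symp, add_dotProduct]; ring)
    (by intros; simp [symp]; ring)
    (by intros; simp [symp, dotProduct_add]; ring)
    (by intros; simp [symp]; ring)

theorem sympForm_apply (β : Module.Basis (Fin 2) K E) (x y : Fin n → E) :
    sympForm β x y = symp (coords β x) (coords β y) := rfl

variable [Fintype K]

/-- If the determinant vanished, Frobenius would be multiplication by a constant `t` on the basis,
hence everywhere; evaluating at `1` gives `t = 1`, but Frobenius is not the identity on `E`. -/
theorem det_frobenius_ne_zero (hE : Module.finrank K E = 2) (β : Module.Basis (Fin 2) K E) :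
    β 0 * β 1 ^ Fintype.card K - β 1 * β 0 ^ Fintype.card K ≠ 0 := by
  intro h
  have hβ : β 0 ≠ 0 := β.ne_zero 0
  obtain ⟨e, he⟩ := exists_pow_card_ne_self (K := K) hE
  set t := β 0 ^ Fintype.card K / β 0 with ht
  have h0 : β 0 ^ Fintype.card K = t * β 0 := by rw [ht]; field_simp
  have h1 : β 1 ^ Fintype.card K = t * β 1 := by
    rw [ht]; field_simp; linear_combination h
  have hlin : (FiniteField.frobeniusAlgHom K E).toLinearMap = LinearMap.mulLeft K t := by
    refine β.ext fun i => ?_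
    fin_cases i
    · simpa using h0
    · simpa using h1
  have hall : ∀ x : E, x ^ Fintype.card K = t * x := fun x => by
    simpa using LinearMap.congr_fun hlin x
  have ht1 : t = 1 := by simpa using (hall 1).symm
  exact he (by rw [hall, ht1, one_mul])

/-- Frobenius fixes the coordinates in `K`, so antisymmetrizing the Hermitian form leaves only the
symplectic form times a constant. -/
theorem algebraMap_sympForm (β : Module.Basis (Fin 2) K E) (x y : Fin n → E) :
    algebraMap K E (sympForm β x y) *
        (β 0 * β 1 ^ Fintype.card K - β 1 * β 0 ^ Fintype.card K) =
      ∑ i, x i * y i ^ Fintype.card K - ∑ i, y i * x i ^ Fintype.card K := by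
  have hrepr : ∀ (z : Fin n → E) i, z i = algebraMap K E ((coords β z).1 i) * β 0 +
      algebraMap K E ((coords β z).2 i) * β 1 := by
    intro z i
    conv_lhs => rw [← β.sum_repr (z i)]
    rw [Fin.sum_univ_two, coords_fst, coords_snd, Algebra.smul_def, Algebra.smul_def]
  have hfrob : ∀ (z : Fin n → E) i, z i ^ Fintype.card K =
      algebraMap K E ((coords β z).1 i) * β 0 ^ Fintype.card K +
      algebraMap K E ((coords β z).2 i) * β 1 ^ Fintype.card K := by
    intro z i
    conv_lhs => rw [hrepr z i]
    rw [add_pow_card (K := K), mul_pow, mul_pow, ← map_pow (algebraMap K E),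
      ← map_pow (algebraMap K E), FiniteField.pow_card, FiniteField.pow_card]
  rw [sympForm_apply, symp, dotProduct, dotProduct, ← Finset.sum_sub_distrib,
    ← Finset.sum_sub_distrib, map_sum, Finset.sum_mul]
  refine Finset.sum_congr rfl fun i _ => ?_
  rw [hfrob x i, hfrob y i]
  conv_rhs => rw [hrepr x i, hrepr y i]
  simp only [map_sub, map_mul]
  ring

/-- Symplectic orthogonality only says that the Hermitian product is fixed by Frobenius. Since `C`
is `E`-linear, this also holds for `e • y` with `e ^ q ≠ e`, which forces the product to be zero. -/
theorem mem_hermitianDual_iff_sympForm (hE : Module.finrank K E = 2)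
    (β : Module.Basis (Fin 2) K E) (C : Submodule E (Fin n → E)) (x : Fin n → E) :
    x ∈ hermitianDual K C ↔ ∀ y ∈ C, sympForm β x y = 0 := by
  constructor
  · intro hx y hy
    have h := algebraMap_sympForm β x y
    rw [hx y hy, hermitian_eq_zero_comm hE (hx y hy), sub_zero] at h
    simpa using (mul_eq_zero.1 h).resolve_right (det_frobenius_ne_zero hE β)
  · intro h
    have key : ∀ y ∈ C, (∑ i, x i * y i ^ Fintype.card K) ^ Fintype.card K =
        ∑ i, x i * y i ^ Fintype.card K := by
      intro y hy
      have h1 := algebraMap_sympForm β x y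
      rw [h y hy, map_zero, zero_mul, eq_comm, sub_eq_zero] at h1
      rw [hermitian_comm hE, h1]
    obtain ⟨e, he⟩ := exists_pow_card_ne_self (K := K) hE
    intro y hy
    have h1 := key (e • y) (C.smul_mem e hy)
    have h2 : ∑ i, x i * (e • y) i ^ Fintype.card K =
        e ^ Fintype.card K * ∑ i, x i * y i ^ Fintype.card K := by
      rw [Finset.mul_sum]
      refine Finset.sum_congr rfl fun i _ => ?_
      rw [Pi.smul_apply, smul_eq_mul, mul_pow]
      ring
    rw [h2, mul_pow, pow_card_pow_card hE, key y hy] at h1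
    have h3 : (e ^ Fintype.card K - e) * ∑ i, x i * y i ^ Fintype.card K = 0 := by
      linear_combination -h1
    exact (mul_eq_zero.1 h3).resolve_left (sub_ne_zero.2 he)

theorem exists_symplectic_reduction (hE : Module.finrank K E = 2)
    (β : Module.Basis (Fin 2) K E) (C : Submodule E (Fin n → E)) (c : ℕ)
    (hc : c + Module.finrank E (hermitianHull K C) = Module.finrank E C) :
    ∃ θ : C.restrictScalars K →ₗ[K] (Fin c → K) × (Fin c → K), Function.Surjective θ ∧
      ∀ x y : C.restrictScalars K, sympForm β (x : Fin n → E) y = symp (θ x) (θ y) := by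
  have : Module.Finite K E := Module.finite_of_finrank_pos (by omega)
  obtain ⟨m, θ, hθ, hθB⟩ := exists_surjective_symp_eq
    ((sympForm β).domRestrict₁₂ (C.restrictScalars K) (C.restrictScalars K))
    (fun x => by
      simp [LinearMap.domRestrict₁₂_apply, sympForm_apply, symp, dotProduct_comm])
  -- As `θ` is onto a nondegenerate space, its kernel is the radical of the form on `C`, that is,
  -- the hull; counting dimensions over `K` then gives `m = c`.
  have hker : ∀ x : C.restrictScalars K, θ x = 0 ↔ (x : Fin n → E) ∈ hermitianDual K C := by
    intro x
    rw [mem_hermitianDual_iff_sympForm hE β]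
    constructor
    · intro hx y hy
      have := hθB x ⟨y, hy⟩
      rwa [hx, symp_zero_left] at this
    · intro hx
      refine eq_zero_of_symp_eq_zero fun w => ?_
      obtain ⟨y, rfl⟩ := hθ w
      rw [← hθB]
      exact hx y y.2
  have hkerhull : (LinearMap.ker θ).map (C.restrictScalars K).subtype =
      (hermitianHull K C).restrictScalars K := by
    ext x
    constructor
    · rintro ⟨y, hy, rfl⟩
      exact ⟨y.2, (hker y).1 hy⟩
    · rintro ⟨hx, hx'⟩
      exact ⟨⟨x, hx⟩, (hker ⟨x, hx⟩).2 hx', rfl⟩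
  have h1 := θ.finrank_range_add_finrank_ker
  rw [LinearMap.range_eq_top.2 hθ, finrank_top, Module.finrank_prod, Module.finrank_fin_fun,
    ← Submodule.finrank_map_subtype_eq, hkerhull] at h1
  have h2 : Module.finrank K ((hermitianHull K C).restrictScalars K) =
      2 * Module.finrank E (hermitianHull K C) := by
    rw [← hE, Module.finrank_mul_finrank K E]; rfl
  have h3 : Module.finrank K (C.restrictScalars K) = 2 * Module.finrank E C := by
    rw [← hE, Module.finrank_mul_finrank K E]; rfl
  obtain rfl : m = c := by omega
  exact ⟨θ, hθ, hθB⟩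

end Coordinates

/-! ### Pauli operators and expansions in them -/

section Pauli

variable {K : Type*} [Field K] [DecidableEq K] {m n c : ℕ} {χ : AddChar K ℂ}

theorem pauli_apply (a b x y : Fin m → K) :
    pauli χ a b x y = if x = y + a then χ (b ⬝ᵥ y) else 0 := rfl

theorem pauli_zero : pauli χ (0 : Fin m → K) 0 = 1 := by
  ext x y
  simp [pauli_apply, Matrix.one_apply]

theorem supportedOn_pauli {S : Finset (Fin m)} {a b : Fin m → K}
    (h : ∀ i ∉ S, a i = 0 ∧ b i = 0) : SupportedOn S (pauli χ a b) := by
  refine ⟨fun u v => if u = v + (fun i : S => a i) then χ (∑ i : S, b i * v i) else 0,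
    fun x y => ?_⟩
  have h1 : b ⬝ᵥ y = ∑ i : S, b i * y i := by
    rw [dotProduct, Finset.sum_coe_sort S (fun i => b i * y i)]
    refine (Finset.sum_subset (Finset.subset_univ S) fun i _ hi => ?_).symm
    rw [(h i hi).2, zero_mul]
  have h2 : x = y + a ↔ (∀ i, i ∉ S → x i = y i) ∧
      (fun i : S => x i) = (fun i : S => y i) + (fun i : S => a i) := by
    constructor
    · rintro rfl
      exact ⟨fun i hi => by simp [(h i hi).1], rfl⟩
    · rintro ⟨h3, h4⟩
      ext i
      by_cases hi : i ∈ S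
      · exact congrFun h4 ⟨i, hi⟩
      · simp [h3 i hi, (h i hi).1]
  rw [pauli_apply, h1]
  simp only [h2, ite_and]

/-- The Pauli operator `X(v.1) Z(v.2) ⊗ X(w.1) Z(w.2)` on Alice's and Bob's qudits. -/
def biPauli (χ : AddChar K ℂ) (v : (Fin n → K) × (Fin n → K)) (w : (Fin c → K) × (Fin c → K)) :
    Matrix ((Fin n → K) × (Fin c → K)) ((Fin n → K) × (Fin c → K)) ℂ :=
  pauli χ v.1 v.2 ⊗ₖ pauli χ w.1 w.2

theorem biPauli_zero_right (v : (Fin n → K) × (Fin n → K)) :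
    biPauli χ v (0 : (Fin c → K) × (Fin c → K)) = pauli χ v.1 v.2 ⊗ₖ 1 := by
  rw [biPauli, Prod.fst_zero, Prod.snd_zero, pauli_zero]

theorem biPauli_zero_left (w : (Fin c → K) × (Fin c → K)) :
    biPauli χ (0 : (Fin n → K) × (Fin n → K)) w = 1 ⊗ₖ pauli χ w.1 w.2 := by
  rw [biPauli, Prod.fst_zero, Prod.snd_zero, pauli_zero]

variable [Fintype K]

theorem pauli_mul (a b a' b' : Fin m → K) :
    pauli χ a b * pauli χ a' b' = χ (b ⬝ᵥ a') • pauli χ (a + a') (b + b') := by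
  ext x y
  simp only [Matrix.mul_apply, Matrix.smul_apply, pauli_apply, smul_eq_mul, mul_ite, mul_zero]
  rw [Finset.sum_ite_eq' Finset.univ (y + a')]
  simp only [Finset.mem_univ, if_true]
  have h : x = y + a' + a ↔ x = y + (a + a') := by rw [add_assoc, add_comm a']
  simp only [h]
  split_ifs
  · rw [← AddChar.map_add_eq_mul, ← AddChar.map_add_eq_mul, dotProduct_add, add_dotProduct]
    congr 1
    ring
  · simp

theorem conjTranspose_pauli_mul_self (a b : Fin m → K) :
    (pauli χ a b)ᴴ * pauli χ a b = 1 := by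
  ext x y
  simp only [Matrix.mul_apply, Matrix.conjTranspose_apply, pauli_apply, mul_ite, mul_zero]
  rw [Finset.sum_ite_eq' Finset.univ (y + a)]
  by_cases h : y = x
  · subst h
    simp [← Complex.normSq_eq_conj_mul_self, Complex.normSq_eq_norm_sq]
  · have h' : ¬ x = y := fun e => h e.symm
    simp [h, h']

theorem sum_addChar_dotProduct (hχ : χ ≠ 1) (z : Fin m → K) :
    ∑ b : Fin m → K, χ (b ⬝ᵥ z) = if z = 0 then (Fintype.card K : ℂ) ^ m else 0 := by
  split_ifs with h
  · simp [h]
  · obtain ⟨i, hi⟩ := Function.ne_iff.1 h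
    obtain ⟨t, ht⟩ := AddChar.ne_one_iff.1 hχ
    let ψ : AddChar (Fin m → K) ℂ :=
      { toFun := fun b => χ (b ⬝ᵥ z)
        map_zero_eq_one' := by simp
        map_add_eq_mul' := fun b b' => by rw [add_dotProduct, AddChar.map_add_eq_mul] }
    refine AddChar.sum_eq_zero_of_ne_one (ψ := ψ)
      (AddChar.ne_one_iff.2 ⟨Pi.single i (t / z i), ?_⟩)
    change χ (Pi.single i (t / z i) ⬝ᵥ z) ≠ 1
    rwa [single_dotProduct, div_mul_cancel₀ _ hi]

theorem trace_pauli (hχ : χ ≠ 1) {a b : Fin m → K} (h : (a, b) ≠ 0) :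
    (pauli χ a b).trace = 0 := by
  simp only [Matrix.trace, Matrix.diag_apply, pauli_apply, left_eq_add]
  split_ifs with ha
  · simp only [dotProduct_comm b]
    rw [sum_addChar_dotProduct hχ, if_neg]
    rintro rfl
    exact h (by rw [ha]; rfl)
  · simp

/-- The coefficient of `X(a) Z(b)` in the expansion of `A` in Pauli operators. -/
noncomputable def pauliCoeff (χ : AddChar K ℂ) (A : Matrix (Fin m → K) (Fin m → K) ℂ)
    (a b : Fin m → K) : ℂ :=
  ((Fintype.card K : ℂ) ^ m)⁻¹ * ∑ y, A (y + a) y * χ (-(b ⬝ᵥ y))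

/-- Fourier inversion along each shifted diagonal `x - y = a`. -/
theorem sum_pauliCoeff_smul_pauli (hχ : χ ≠ 1) (A : Matrix (Fin m → K) (Fin m → K) ℂ) :
    ∑ a, ∑ b, pauliCoeff χ A a b • pauli χ a b = A := by
  have hq : ((Fintype.card K : ℂ) ^ m) ≠ 0 :=
    pow_ne_zero _ (Nat.cast_ne_zero.2 Fintype.card_ne_zero)
  ext x y
  simp only [Matrix.sum_apply, Matrix.smul_apply, pauli_apply, smul_eq_mul]
  rw [Finset.sum_eq_single (x - y)]
  · simp only [add_sub_cancel, if_true, pauliCoeff, mul_assoc, ← Finset.mul_sum, Finset.sum_mul]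
    rw [Finset.sum_comm]
    have : ∀ z, ∑ b : Fin m → K, A (z + (x - y)) z * (χ (-(b ⬝ᵥ z)) * χ (b ⬝ᵥ y)) =
        if z = y then A x y * (Fintype.card K : ℂ) ^ m else 0 := by
      intro z
      have h1 : ∀ b : Fin m → K, χ (-(b ⬝ᵥ z)) * χ (b ⬝ᵥ y) = χ (b ⬝ᵥ (y - z)) := by
        intro b
        rw [← AddChar.map_add_eq_mul, dotProduct_sub, neg_add_eq_sub]
      simp only [h1]
      rw [← Finset.mul_sum, sum_addChar_dotProduct hχ]
      by_cases h : z = y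
      · subst h; simp
      · rw [if_neg h, if_neg (fun e => h (sub_eq_zero.1 e).symm), mul_zero]
    simp only [this, Finset.sum_ite_eq', Finset.mem_univ, if_true]
    field_simp
  · intro a _ ha
    refine Finset.sum_eq_zero fun b _ => ?_
    rw [if_neg, mul_zero]
    rintro rfl
    simp at ha
  · simp

theorem SupportedOn.pauliCoeff_eq_zero (hχ : χ ≠ 1) {S : Finset (Fin m)}
    {A : Matrix (Fin m → K) (Fin m → K) ℂ} (hA : SupportedOn S A) {a b : Fin m → K} {i : Fin m}
    (hi : i ∉ S) (hab : a i ≠ 0 ∨ b i ≠ 0) : pauliCoeff χ A a b = 0 := by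
  obtain ⟨M, hM⟩ := hA
  rw [pauliCoeff, mul_eq_zero]
  right
  rcases hab with ha | hb
  · refine Finset.sum_eq_zero fun y _ => ?_
    rw [hM, if_neg, zero_mul]
    intro h
    have := h i hi
    simp [ha] at this
  · obtain ⟨t, ht⟩ := AddChar.ne_one_iff.1 hχ
    -- Translating by `e` fixes the relevant entries of `A`, as `i ∉ S`, and multiplies the
    -- character by `χ t ≠ 1`, since `-(b ⬝ᵥ e) = t`. So the sum vanishes.
    set e : Fin m → K := Pi.single i (-t / b i)
    have he : ∀ k ∈ S, e k = 0 := fun k hk =>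
      Pi.single_eq_of_ne (ne_of_mem_of_not_mem hk hi) _
    have hAe : ∀ y, A (y + e + a) (y + e) = A (y + a) y := by
      intro y
      rw [hM, hM]
      have h1 : (fun k : S => (y + e + a) k) = fun k : S => (y + a) k := by
        ext k; simp [he k k.2]
      have h2 : (fun k : S => (y + e) k) = fun k : S => y k := by
        ext k; simp [he k k.2]
      rw [h1, h2]
      simp
    have hshift : ∑ y, A (y + a) y * χ (-(b ⬝ᵥ y)) =
        χ t * ∑ y, A (y + a) y * χ (-(b ⬝ᵥ y)) := by
      conv_lhs => rw [← Equiv.sum_comp (Equiv.addRight e)]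
      rw [Finset.mul_sum]
      refine Finset.sum_congr rfl fun y _ => ?_
      rw [Equiv.coe_addRight, hAe, dotProduct_add, dotProduct_single, neg_add,
        AddChar.map_add_eq_mul, mul_div_cancel₀ _ hb, neg_neg]
      ring
    have : (1 - χ t) * ∑ y, A (y + a) y * χ (-(b ⬝ᵥ y)) = 0 := by
      linear_combination hshift
    exact (mul_eq_zero.1 this).resolve_left (sub_ne_zero.2 (Ne.symm ht))

/-- The Pauli operators acting on the qudits in `S`. -/
def pauliSet (χ : AddChar K ℂ) (S : Finset (Fin m)) : Set (Matrix (Fin m → K) (Fin m → K) ℂ) :=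
  {M | ∃ a b : Fin m → K, (∀ i ∉ S, a i = 0 ∧ b i = 0) ∧ M = pauli χ a b}

theorem SupportedOn.mem_span_pauliSet (hχ : χ ≠ 1) {S : Finset (Fin m)}
    {A : Matrix (Fin m → K) (Fin m → K) ℂ} (hA : SupportedOn S A) :
    A ∈ Submodule.span ℂ (pauliSet χ S) := by
  rw [← sum_pauliCoeff_smul_pauli hχ A]
  refine Submodule.sum_mem _ fun a _ => Submodule.sum_mem _ fun b _ => ?_
  by_cases h : ∀ i ∉ S, a i = 0 ∧ b i = 0
  · exact Submodule.smul_mem _ _ (Submodule.subset_span ⟨a, b, h, rfl⟩)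
  · push Not at h
    obtain ⟨i, hi, hab⟩ := h
    rw [hA.pauliCoeff_eq_zero hχ hi (by tauto), zero_smul]
    exact zero_mem _

theorem mem_span_pauliSet_univ (hχ : χ ≠ 1) (A : Matrix (Fin m → K) (Fin m → K) ℂ) :
    A ∈ Submodule.span ℂ (pauliSet χ Finset.univ) :=
  SupportedOn.mem_span_pauliSet hχ
    ⟨fun u v => A (fun i => u ⟨i, Finset.mem_univ i⟩) (fun i => v ⟨i, Finset.mem_univ i⟩),
      fun x y => by simp⟩

theorem biPauli_mul (v v' : (Fin n → K) × (Fin n → K)) (w w' : (Fin c → K) × (Fin c → K)) :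
    biPauli χ v w * biPauli χ v' w' =
      χ (v.2 ⬝ᵥ v'.1 + w.2 ⬝ᵥ w'.1) • biPauli χ (v + v') (w + w') := by
  rw [biPauli, biPauli, ← Matrix.mul_kronecker_mul, pauli_mul, pauli_mul, Matrix.smul_kronecker,
    Matrix.kronecker_smul, smul_smul, ← AddChar.map_add_eq_mul]
  rfl

theorem biPauli_mul_comm (v v' : (Fin n → K) × (Fin n → K)) (w w' : (Fin c → K) × (Fin c → K)) :
    biPauli χ v w * biPauli χ v' w' =
      χ (symp v' v + symp w' w) • (biPauli χ v' w' * biPauli χ v w) := by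
  rw [biPauli_mul, biPauli_mul, smul_smul, ← AddChar.map_add_eq_mul, add_comm v', add_comm w']
  congr 2
  simp only [symp, dotProduct_comm v.2, dotProduct_comm w.2]
  ring

theorem conjTranspose_biPauli_mul_self (v : (Fin n → K) × (Fin n → K))
    (w : (Fin c → K) × (Fin c → K)) : (biPauli χ v w)ᴴ * biPauli χ v w = 1 := by
  rw [biPauli, Matrix.conjTranspose_kronecker, ← Matrix.mul_kronecker_mul,
    conjTranspose_pauli_mul_self, conjTranspose_pauli_mul_self, Matrix.one_kronecker_one]

theorem trace_biPauli (hχ : χ ≠ 1) {v : (Fin n → K) × (Fin n → K)}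
    {w : (Fin c → K) × (Fin c → K)} (h : v ≠ 0 ∨ w ≠ 0) : (biPauli χ v w).trace = 0 := by
  rw [biPauli, Matrix.trace_kronecker]
  rcases h with h | h
  · rw [trace_pauli hχ h, zero_mul]
  · rw [trace_pauli hχ h, mul_zero]

end Pauli

/-! ### Commuting unitary families and their fixed spaces -/

section StabilizerGroup

/-- On a nonzero invariant subspace of least dimension every `f i` is scalar, since its eigenspace
there is again invariant under the commuting family. -/
theorem exists_common_eigenvector {ι V : Type*} [AddCommGroup V] [Module ℂ V]
    [FiniteDimensional ℂ V] [Nontrivial V] (f : ι → Module.End ℂ V)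
    (hf : ∀ i j, Commute (f i) (f j)) : ∃ v : V, v ≠ 0 ∧ ∀ i, ∃ μ : ℂ, f i v = μ • v := by
  classical
  have hex : ∃ d, ∃ W : Submodule ℂ V, W ≠ ⊥ ∧ (∀ i, ∀ w ∈ W, f i w ∈ W) ∧
      Module.finrank ℂ W = d := ⟨_, ⊤, top_ne_bot, fun _ _ _ => Submodule.mem_top, rfl⟩
  obtain ⟨W, hW, hinv, hd⟩ := Nat.find_spec hex
  have hmin : ∀ W' : Submodule ℂ V, W' ≠ ⊥ → (∀ i, ∀ w ∈ W', f i w ∈ W') → W' ≤ W → W' = W :=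
    fun W' h1 h2 h3 => Submodule.eq_of_le_of_finrank_le h3
      (hd ▸ Nat.find_min' hex ⟨W', h1, h2, rfl⟩)
  have hscalar : ∀ i, ∃ μ : ℂ, ∀ w ∈ W, f i w = μ • w := by
    intro i
    have : Nontrivial W := Submodule.nontrivial_iff_ne_bot.2 hW
    obtain ⟨μ, hμ⟩ := Module.End.exists_eigenvalue ((f i).restrict (hinv i))
    obtain ⟨w, hw⟩ := hμ.exists_hasEigenvector
    have hw1 : f i w = μ • (w : V) := congrArg Subtype.val hw.apply_eq_smul
    have hWW : W ⊓ (f i).eigenspace μ = W := by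
      refine hmin _ ?_ ?_ inf_le_left
      · refine (Submodule.ne_bot_iff _).2 ⟨w, ⟨w.2, Module.End.mem_eigenspace_iff.2 hw1⟩, ?_⟩
        simpa using hw.2
      · rintro j u ⟨hu, hu'⟩
        refine ⟨hinv j u hu, Module.End.mem_eigenspace_iff.2 ?_⟩
        have h1 : f i (f j u) = f j (f i u) := LinearMap.congr_fun (hf i j) u
        rw [h1, Module.End.mem_eigenspace_iff.1 hu', map_smul]
    exact ⟨μ, fun w hw => Module.End.mem_eigenspace_iff.1 (hWW.ge hw).2⟩
  obtain ⟨v, hv, hv0⟩ := Submodule.exists_mem_ne_zero_of_ne_bot hW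
  exact ⟨v, hv0, fun i => (hscalar i).imp fun μ h => h v hv⟩

variable {G ι : Type*} [Fintype ι]

/-- The vectors fixed by all the matrices `S g`. -/
def jointFixed (S : G → Matrix ι ι ℂ) : Submodule ℂ (ι → ℂ) where
  carrier := {w | ∀ g, S g *ᵥ w = w}
  zero_mem' := fun g => Matrix.mulVec_zero _
  add_mem' := fun {v w} hv hw g => by rw [Matrix.mulVec_add, hv g, hw g]
  smul_mem' := fun r w hw g => by rw [Matrix.mulVec_smul, hw g]

theorem mem_jointFixed {S : G → Matrix ι ι ℂ} {w : ι → ℂ} :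
    w ∈ jointFixed S ↔ ∀ g, S g *ᵥ w = w := Iff.rfl

theorem sum_mulVec_of_mem [Fintype G] {S : G → Matrix ι ι ℂ} {v : ι → ℂ} (hv : v ∈ jointFixed S) :
    (∑ g, S g) *ᵥ v = (Fintype.card G : ℂ) • v := by
  rw [Matrix.sum_mulVec]
  simp [mem_jointFixed.1 hv, ← Nat.cast_smul_eq_nsmul ℂ]

variable [AddCommGroup G]

theorem sum_mulVec_mem_jointFixed [Fintype G] {S : G → Matrix ι ι ℂ}
    (hS : ∀ g h, S g * S h = S (g + h)) (v : ι → ℂ) :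
    (∑ g, S g) *ᵥ v ∈ jointFixed S := by
  intro h
  rw [Matrix.mulVec_mulVec, Finset.mul_sum]
  simp only [hS]
  exact congrArg (· *ᵥ v) (Equiv.sum_comp (Equiv.addLeft h) S)

variable [DecidableEq ι]

open scoped ComplexOrder in
-- Dividing each operator by its eigenvalue on a common eigenvector makes them all fix that vector,
-- which forces the scalars in the multiplication law to be `1`.
theorem exists_phases [Nonempty ι] (P : G → Matrix ι ι ℂ)
    (hmul : ∀ g h, ∃ t : ℂ, P g * P h = t • P (g + h))
    (hunit : ∀ g, (P g)ᴴ * P g = 1) (hcomm : ∀ g h, P g * P h = P h * P g) :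
    ∃ z : G → ℂ, (∀ g h, (z g • P g) * (z h • P h) = z (g + h) • P (g + h)) ∧
      ∀ g, (z g • P g)ᴴ * (z g • P g) = 1 := by
  obtain ⟨ψ, hψ, heig⟩ := exists_common_eigenvector (fun g => (P g).mulVecLin) (fun g h => by
    change (P g).mulVecLin ∘ₗ (P h).mulVecLin = (P h).mulVecLin ∘ₗ (P g).mulVecLin
    rw [← Matrix.mulVecLin_mul, ← Matrix.mulVecLin_mul, hcomm])
  choose ζ hζ using heig
  simp only [Matrix.mulVecLin_apply] at hζ
  have hψψ : star ψ ⬝ᵥ ψ ≠ 0 := by rwa [Ne, dotProduct_star_self_eq_zero]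
  have hnorm : ∀ g, star (ζ g) * ζ g = 1 := by
    intro g
    have h1 : star (P g *ᵥ ψ) ⬝ᵥ (P g *ᵥ ψ) = star ψ ⬝ᵥ ψ := by
      rw [Matrix.star_mulVec, ← Matrix.dotProduct_mulVec, Matrix.mulVec_mulVec, hunit,
        Matrix.one_mulVec]
    rw [hζ, star_smul, smul_dotProduct, dotProduct_smul, smul_smul, smul_eq_mul] at h1
    exact mul_right_cancel₀ hψψ (h1.trans (one_mul _).symm)
  have hζ0 : ∀ g, ζ g ≠ 0 := fun g h => by simpa [h] using hnorm g
  refine ⟨fun g => (ζ g)⁻¹, fun g h => ?_, fun g => ?_⟩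
  · obtain ⟨t, ht⟩ := hmul g h
    have h1 : (P g * P h) *ᵥ ψ = (t • P (g + h)) *ᵥ ψ := by rw [ht]
    rw [← Matrix.mulVec_mulVec, hζ, Matrix.mulVec_smul, hζ, Matrix.smul_mulVec, hζ, smul_smul,
      smul_smul] at h1
    have h2 : ζ h * ζ g = t * ζ (g + h) := smul_left_injective ℂ hψ h1
    rw [smul_mul_smul_comm, ht, smul_smul]
    congr 1
    have := hζ0 g
    have := hζ0 h
    have := hζ0 (g + h)
    field_simp
    rw [← h2]
    ring
  · rw [Matrix.conjTranspose_smul, smul_mul_smul_comm, hunit, star_inv₀, ← mul_inv, hnorm,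
      inv_one, one_smul]

variable [Fintype G] {S : G → Matrix ι ι ℂ}

/-- The group average projects onto the fixed space, so its trace is the dimension. -/
theorem finrank_jointFixed_mul_card (hS : ∀ g h, S g * S h = S (g + h)) :
    (Module.finrank ℂ (jointFixed S) : ℂ) * Fintype.card G = ∑ g, (S g).trace := by
  have hG : (Fintype.card G : ℂ) ≠ 0 := Nat.cast_ne_zero.2 Fintype.card_ne_zero
  have hproj : LinearMap.IsProj (jointFixed S)
      (Matrix.toLin' ((Fintype.card G : ℂ)⁻¹ • ∑ g, S g)) := by
    constructor
    · intro v
      rw [Matrix.toLin'_apply, Matrix.smul_mulVec]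
      exact Submodule.smul_mem _ _ (sum_mulVec_mem_jointFixed hS v)
    · intro v hv
      rw [Matrix.toLin'_apply, Matrix.smul_mulVec, sum_mulVec_of_mem hv, smul_smul,
        inv_mul_cancel₀ hG, one_smul]
  rw [← hproj.trace, Matrix.trace_toLin'_eq, Matrix.trace_smul, Matrix.trace_sum, smul_eq_mul]
  field_simp

end StabilizerGroup

/-! ### The encoding unitary -/

section Encoding

theorem exists_orthonormal_family {I J : Type*} [Fintype I] [Fintype J] [DecidableEq J]
    (Q : Submodule ℂ (I → ℂ)) (h : Module.finrank ℂ Q = Fintype.card J) :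
    ∃ v : J → I → ℂ, (∀ y y', star (v y) ⬝ᵥ v y' = if y = y' then 1 else 0) ∧
      ∀ w, w ∈ Q ↔ ∃ φ : J → ℂ, w = ∑ y, φ y • v y := by
  classical
  let L : EuclideanSpace ℂ I ≃ₗ[ℂ] (I → ℂ) := WithLp.linearEquiv 2 ℂ (I → ℂ)
  let Q₂ : Submodule ℂ (EuclideanSpace ℂ I) := Q.map L.symm.toLinearMap
  have hQ₂ : Module.finrank ℂ Q₂ = Fintype.card J := by
    rw [← h]; exact LinearEquiv.finrank_map_eq L.symm Q
  have hmem : ∀ x, x ∈ Q₂ ↔ L x ∈ Q := fun x => by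
    constructor
    · rintro ⟨w, hw, rfl⟩
      simpa using hw
    · exact fun h => ⟨L x, h, L.symm_apply_apply x⟩
  let b : OrthonormalBasis J ℂ Q₂ := (stdOrthonormalBasis ℂ Q₂).reindex
    (Fintype.equivOfCardEq (by rw [Fintype.card_fin, hQ₂]))
  refine ⟨fun y => L (b y), fun y y' => ?_, fun w => ⟨fun hw => ?_, ?_⟩⟩
  · have h1 := orthonormal_iff_ite.1 b.orthonormal y y'
    rw [Submodule.coe_inner, EuclideanSpace.inner_eq_star_dotProduct, dotProduct_comm] at h1
    exact h1
  · have hw' : L.symm w ∈ Q₂ := (hmem _).2 (by simpa using hw)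
    refine ⟨fun y => b.repr ⟨L.symm w, hw'⟩ y, ?_⟩
    have h1 := congrArg (fun x : Q₂ => L x) (b.sum_repr ⟨L.symm w, hw'⟩)
    simpa using h1.symm
  · rintro ⟨φ, rfl⟩
    exact Submodule.sum_mem _ fun y _ => Submodule.smul_mem _ _ ((hmem _).1 (b y).2)

theorem exists_unitary_extension {I J J' : Type*} [Fintype I] [DecidableEq I] [Fintype J]
    [DecidableEq J] [DecidableEq J'] (hcard : Fintype.card I = Fintype.card J) (u : J' → I → ℂ)
    (hu : ∀ j j', star (u j) ⬝ᵥ u j' = if j = j' then 1 else 0) {f : J' → J}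
    (hf : Function.Injective f) :
    ∃ U : Matrix I J ℂ, Uᴴ * U = 1 ∧ U * Uᴴ = 1 ∧ ∀ j i, U i (f j) = u j i := by
  let v : J → EuclideanSpace ℂ I := Function.extend f (fun j => WithLp.toLp 2 (u j)) 0
  have hv : ∀ j, v (f j) = WithLp.toLp 2 (u j) := hf.extend_apply _ _
  have horth : Orthonormal ℂ ((Set.range f).domRestrict v) := by
    rw [orthonormal_iff_ite]
    rintro ⟨_, j, rfl⟩ ⟨_, j', rfl⟩
    change inner ℂ (v (f j)) (v (f j')) = _
    rw [hv, hv, EuclideanSpace.inner_eq_star_dotProduct, dotProduct_comm]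
    exact (hu j j').trans (if_congr
      ⟨fun h => Subtype.ext (congrArg f h), fun h => hf (congrArg Subtype.val h)⟩ rfl rfl)
  obtain ⟨b, hb⟩ := horth.exists_orthonormalBasis_extension_of_card_eq
    (by rw [finrank_euclideanSpace, hcard])
  have h1 : (Matrix.of fun i j => b j i : Matrix I J ℂ)ᴴ * Matrix.of (fun i j => b j i) = 1 := by
    ext j j'
    have h2 := orthonormal_iff_ite.1 b.orthonormal j j'
    rw [EuclideanSpace.inner_eq_star_dotProduct, dotProduct_comm] at h2
    rw [Matrix.one_apply, ← h2]
    rfl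
  refine ⟨_, h1, (Matrix.mul_eq_one_comm_of_card_eq _ _ _ hcard.symm).1 h1, fun j i => ?_⟩
  rw [Matrix.of_apply, hb _ ⟨j, rfl⟩, hv]

variable {K : Type*} [Field K] [Fintype K] [DecidableEq K] {n c : ℕ}

/-- For an orthonormal basis `v y` of `Q`, the slices `v y (·, b)` on Alice's side are orthogonal
with squared norm `q^(-c)`. Rescaled by `r = √(q^c)`, they are the columns of `U` at ancilla value
`0`; the other columns are an arbitrary completion. -/
theorem isEncoded_of_bob_maximally_mixed (Q : Submodule ℂ ((Fin n → K) × (Fin c → K) → ℂ))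
    {κ a : ℕ} (hn : κ + a + c = n) (hdim : Module.finrank ℂ Q = Fintype.card K ^ κ)
    (hB : ∀ B : Matrix (Fin c → K) (Fin c → K) ℂ, ∀ v ∈ Q, ∀ w ∈ Q,
      star v ⬝ᵥ (((1 : Matrix (Fin n → K) (Fin n → K) ℂ) ⊗ₖ B) *ᵥ w) =
        B.trace / (Fintype.card K : ℂ) ^ c * (star v ⬝ᵥ w)) : IsEncoded Q κ := by
  obtain ⟨v, hv, hQ⟩ := exists_orthonormal_family (J := Fin κ → K) Q (by simpa using hdim)
  have hvQ : ∀ y, v y ∈ Q := fun y =>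
    (hQ _).2 ⟨Pi.single y 1, by simp [Pi.single_apply]⟩
  have hq : (0 : ℝ) < (Fintype.card K : ℝ) ^ c := pow_pos (Nat.cast_pos.2 Fintype.card_pos) c
  have hqC : ((Fintype.card K : ℂ) ^ c) ≠ 0 :=
    pow_ne_zero _ (Nat.cast_ne_zero.2 Fintype.card_ne_zero)
  set r : ℂ := ((Real.sqrt ((Fintype.card K : ℝ) ^ c) : ℝ) : ℂ) with hr
  have hr0 : r ≠ 0 := Complex.ofReal_ne_zero.2 (Real.sqrt_pos.2 hq).ne'
  have hrr : star r * r = (Fintype.card K : ℂ) ^ c := by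
    rw [hr, Complex.star_def, Complex.conj_ofReal, ← Complex.ofReal_mul,
      Real.mul_self_sqrt hq.le]
    push_cast
    rfl
  have hslice : ∀ y y' b b', ∑ s, star (v y (s, b)) * v y' (s, b') =
      (if b = b' then 1 else 0) / (Fintype.card K : ℂ) ^ c * (if y = y' then 1 else 0) := by
    intro y y' b b'
    -- Testing against a matrix unit on Bob's side isolates the inner product of two slices.
    have h := hB (Matrix.single b b' 1) (v y) (hvQ y) (v y') (hvQ y')
    rw [hv] at h
    have htr : (Matrix.single b b' (1 : ℂ)).trace = if b = b' then 1 else 0 := by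
      split_ifs with hbb
      · subst hbb; simp
      · rw [Matrix.trace_single_eq_of_ne _ _ _ hbb]
    rw [htr] at h
    rw [← h]
    simp only [dotProduct, Matrix.mulVec, Fintype.sum_prod_type, Matrix.kronecker_apply,
      Pi.star_apply]
    refine Finset.sum_congr rfl fun s _ => ?_
    rw [Finset.sum_eq_single b]
    · congr 1
      rw [Finset.sum_eq_single s, Finset.sum_eq_single b']
      · simp
      · intro x _ hx; simp [Ne.symm hx]
      · simp
      · intro x _ hx; simp [Ne.symm hx]
      · simp
    · intro x _ hx
      simp [Ne.symm hx]
    · simp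
  obtain ⟨U, hU1, hU2, hU⟩ := exists_unitary_extension (I := Fin n → K)
    (J := (Fin κ → K) × (Fin a → K) × (Fin c → K)) (J' := (Fin κ → K) × (Fin c → K))
    (by simp only [Fintype.card_prod, Fintype.card_fun, Fintype.card_fin, ← pow_add]
        rw [← add_assoc, hn])
    (fun j s => r * v j.1 (s, j.2))
    (fun j j' => by
      have h1 : star (fun s => r * v j.1 (s, j.2)) ⬝ᵥ (fun s => r * v j'.1 (s, j'.2)) =
          star r * r * ∑ s, star (v j.1 (s, j.2)) * v j'.1 (s, j'.2) := by
        rw [dotProduct, Finset.mul_sum]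
        refine Finset.sum_congr rfl fun s _ => ?_
        simp only [Pi.star_apply, star_mul']
        ring
      rw [h1, hslice, hrr]
      by_cases h2 : j.1 = j'.1 <;> by_cases h3 : j.2 = j'.2 <;> simp [Prod.ext_iff, h2, h3, hqC])
    (f := fun j => (j.1, 0, j.2))
    (fun j j' h => by simpa [Prod.ext_iff] using h)
  refine ⟨a, hn, U, hU1, hU2, fun w => (hQ w).trans (exists_congr fun φ => ?_)⟩
  have hkey : (U ⊗ₖ (1 : Matrix (Fin c → K) (Fin c → K) ℂ)) *ᵥ inputState κ a c φ =
      ∑ y, φ y • v y := by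
    ext ⟨s, t⟩
    simp only [Matrix.mulVec, dotProduct, Fintype.sum_prod_type, Matrix.kronecker_apply,
      inputState, Finset.sum_apply, Pi.smul_apply, smul_eq_mul]
    refine Finset.sum_congr rfl fun y _ => ?_
    rw [Finset.sum_eq_single 0, Finset.sum_eq_single t, Finset.sum_eq_single t]
    · have h1 := hU (y, t) s
      simp only at h1
      rw [h1, ← hr]
      simp
      field_simp
    · intro x _ hx; simp [Ne.symm hx]
    · simp
    · intro x _ hx
      refine Finset.sum_eq_zero fun z _ => ?_
      by_cases hz : t = z
      · subst hz; simp [hx]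
      · simp [hz]
    · simp
    · intro x _ hx; simp [hx]
    · simp
  rw [hkey]

end Encoding

/-! ### The quantum code of a linear code -/

section Construction

open scoped ComplexOrder in
-- `A` preserves the code, so if detected it acts there as a scalar `μ`. Multiplying by the group
-- sum and taking traces gives `μ = 0`, impossible for a unitary on a nonzero space.
theorem not_detects_of_trace_eq_zero {G K : Type*} [AddCommGroup G] [Fintype G]
    [DecidableEq K] [Fintype K] {n c : ℕ}
    {S : G → Matrix ((Fin n → K) × (Fin c → K)) ((Fin n → K) × (Fin c → K)) ℂ}
    (hS : ∀ g h, S g * S h = S (g + h)) (hQ : Module.finrank ℂ (jointFixed S) ≠ 0)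
    {A : Matrix (Fin n → K) (Fin n → K) ℂ} (hA : Aᴴ * A = 1)
    (hcomm : ∀ g, S g * (A ⊗ₖ (1 : Matrix (Fin c → K) (Fin c → K) ℂ)) = (A ⊗ₖ 1) * S g)
    (htr : ∀ g, ((A ⊗ₖ (1 : Matrix (Fin c → K) (Fin c → K) ℂ)) * S g).trace = 0) :
    ¬ Detects (jointFixed S) A := by
  rintro ⟨μ, hμ⟩
  set T := A ⊗ₖ (1 : Matrix (Fin c → K) (Fin c → K) ℂ) with hT
  have hscalar : ∀ w ∈ jointFixed S, T *ᵥ w = μ • w := by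
    intro w hw
    have hTw : T *ᵥ w ∈ jointFixed S := fun g => by
      rw [Matrix.mulVec_mulVec, hcomm, ← Matrix.mulVec_mulVec, hw g]
    have hd : T *ᵥ w - μ • w ∈ jointFixed S :=
      Submodule.sub_mem _ hTw (Submodule.smul_mem _ _ hw)
    rw [← sub_eq_zero, ← dotProduct_star_self_eq_zero, dotProduct_sub, hμ _ hd _ hw,
      dotProduct_smul, smul_eq_mul, sub_self]
  have hprod : T * ∑ g, S g = μ • ∑ g, S g := by
    refine Matrix.ext_of_mulVec_single fun i => ?_
    rw [← Matrix.mulVec_mulVec, hscalar _ (sum_mulVec_mem_jointFixed hS _), Matrix.smul_mulVec]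
  have h1 := congrArg Matrix.trace hprod
  rw [Finset.mul_sum, Matrix.trace_sum, Matrix.trace_smul, Matrix.trace_sum,
    ← finrank_jointFixed_mul_card hS, Finset.sum_eq_zero fun g _ => htr g, smul_eq_mul, eq_comm,
    mul_eq_zero, mul_eq_zero] at h1
  have hμ0 : μ = 0 := h1.resolve_right
    (not_or.2 ⟨Nat.cast_ne_zero.2 hQ, Nat.cast_ne_zero.2 Fintype.card_ne_zero⟩)
  have hbot : jointFixed S ≠ ⊥ := fun h => hQ (by rw [h, finrank_bot])
  obtain ⟨w, hw, hw0⟩ := Submodule.exists_mem_ne_zero_of_ne_bot hbot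
  have hTT : Tᴴ * T = 1 := by
    rw [hT, Matrix.conjTranspose_kronecker, ← Matrix.mul_kronecker_mul, hA,
      Matrix.conjTranspose_one, Matrix.one_mul, Matrix.one_kronecker_one]
  apply hw0
  rw [← Matrix.one_mulVec w, ← hTT, ← Matrix.mulVec_mulVec, hscalar w hw, hμ0, zero_smul,
    Matrix.mulVec_zero]

variable {K : Type*} [Field K]

theorem symp_comm {m : ℕ} (v w : (Fin m → K) × (Fin m → K)) : symp v w = -symp w v := by
  simp only [symp, dotProduct_comm v.1, dotProduct_comm v.2]
  ring

theorem symp_swap {m : ℕ} (v w : (Fin m → K) × (Fin m → K)) :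
    symp v.swap w.swap = -symp v w := by
  simp [symp]

theorem symp_smul_left {m : ℕ} (r : K) (v w : (Fin m → K) × (Fin m → K)) :
    symp (r • v) w = r * symp v w := by
  simp [symp, mul_sub]

theorem exists_addChar_mul_ne_one {χ : AddChar K ℂ} (hχ : χ ≠ 1) {s : K} (hs : s ≠ 0) :
    ∃ r : K, χ (r * s) ≠ 1 := by
  obtain ⟨t, ht⟩ := AddChar.ne_one_iff.1 hχ
  exact ⟨t / s, by rwa [div_mul_cancel₀ _ hs]⟩

/-- Both sides are linear in `A`; this reduces purity and Bob's mixedness to Pauli operators. -/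
theorem trace_expectation_of_mem_span {I J : Type*} [Fintype I] [Fintype J]
    (Q : Submodule ℂ (J → ℂ)) (F : Matrix I I ℂ →ₗ[ℂ] Matrix J J ℂ) (D : ℂ)
    (s : Set (Matrix I I ℂ))
    (hs : ∀ M ∈ s, ∀ v ∈ Q, ∀ w ∈ Q, star v ⬝ᵥ (F M *ᵥ w) = M.trace / D * (star v ⬝ᵥ w))
    {A : Matrix I I ℂ} (hA : A ∈ Submodule.span ℂ s) :
    ∀ v ∈ Q, ∀ w ∈ Q, star v ⬝ᵥ (F A *ᵥ w) = A.trace / D * (star v ⬝ᵥ w) := by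
  induction hA using Submodule.span_induction with
  | mem M hM => exact hs M hM
  | zero => intros; simp
  | add M N _ _ hM hN =>
    intro v hv w hw
    rw [map_add, Matrix.add_mulVec, dotProduct_add, hM v hv w hw, hN v hv w hw, Matrix.trace_add]
    ring
  | smul r M _ hM =>
    intro v hv w hw
    rw [map_smul, Matrix.smul_mulVec, dotProduct_smul, hM v hv w hw, Matrix.trace_smul,
      smul_eq_mul, smul_eq_mul]
    ring

variable [DecidableEq K] [Fintype K] {n c : ℕ} {χ : AddChar K ℂ}

/-- Moving a stabilizer across the operator multiplies the matrix element by a phase other than `1`.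
-/
theorem biPauli_expectation_eq_zero {z : ℂ} {v₀ v₁ : (Fin n → K) × (Fin n → K)}
    {w₀ w₁ : (Fin c → K) × (Fin c → K)}
    (hunit : (z • biPauli χ v₀ w₀)ᴴ * (z • biPauli χ v₀ w₀) = 1)
    (hχ : χ (symp v₀ v₁ + symp w₀ w₁) ≠ 1) {φ ψ : (Fin n → K) × (Fin c → K) → ℂ}
    (hφ : (z • biPauli χ v₀ w₀) *ᵥ φ = φ) (hψ : (z • biPauli χ v₀ w₀) *ᵥ ψ = ψ) :
    star φ ⬝ᵥ (biPauli χ v₁ w₁ *ᵥ ψ) = 0 := by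
  have hcomm : biPauli χ v₁ w₁ * (z • biPauli χ v₀ w₀) =
      χ (symp v₀ v₁ + symp w₀ w₁) • ((z • biPauli χ v₀ w₀) * biPauli χ v₁ w₁) := by
    rw [Matrix.mul_smul, biPauli_mul_comm, smul_comm, Matrix.smul_mul]
  have h1 : star φ ⬝ᵥ (biPauli χ v₁ w₁ *ᵥ ψ) =
      χ (symp v₀ v₁ + symp w₀ w₁) * (star φ ⬝ᵥ (biPauli χ v₁ w₁ *ᵥ ψ)) := by
    conv_lhs => rw [← hφ, ← hψ]
    rw [Matrix.star_mulVec, ← Matrix.dotProduct_mulVec, Matrix.mulVec_mulVec,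
      Matrix.mulVec_mulVec, Matrix.mul_assoc, hcomm, Matrix.mul_smul, ← Matrix.mul_assoc,
      hunit, Matrix.one_mul, Matrix.smul_mulVec, dotProduct_smul, smul_eq_mul]
  have h2 : (1 - χ (symp v₀ v₁ + symp w₀ w₁)) * (star φ ⬝ᵥ (biPauli χ v₁ w₁ *ᵥ ψ)) = 0 := by
    linear_combination h1
  exact (mul_eq_zero.1 h2).resolve_left (sub_ne_zero.2 (Ne.symm hχ))

variable {E : Type*} [Field E] [Algebra K E]

theorem exists_stabilizer_representation (hE : Module.finrank K E = 2) (hχ : χ ≠ 1)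
    (β : Module.Basis (Fin 2) K E) (C : Submodule E (Fin n → E)) {κ : ℕ}
    (hc : c + Module.finrank E (hermitianHull K C) = Module.finrank E C)
    (hκ : κ + 2 * Module.finrank E C = n + c) :
    ∃ (θ : C.restrictScalars K →ₗ[K] (Fin c → K) × (Fin c → K))
      (S : C.restrictScalars K →
        Matrix ((Fin n → K) × (Fin c → K)) ((Fin n → K) × (Fin c → K)) ℂ),
      Function.Surjective θ ∧
      (∀ x, ∃ z : ℂ, S x = z • biPauli χ (coords β (x : Fin n → E)) (θ x)) ∧
      (∀ x y, S x * S y = S (x + y)) ∧ (∀ x, (S x)ᴴ * S x = 1) ∧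
      Module.finrank ℂ (jointFixed S) = Fintype.card K ^ κ := by
  have : Module.Finite K E := Module.finite_of_finrank_pos (by omega)
  have : Finite (C.restrictScalars K) := Module.finite_of_finite K
  have := Fintype.ofFinite (C.restrictScalars K)
  obtain ⟨θ', hθ', hθB⟩ := exists_symplectic_reduction hE β C c hc
  -- Swapping the two components negates the symplectic form, so Alice's and Bob's commutation
  -- phases cancel.
  let θ : C.restrictScalars K →ₗ[K] (Fin c → K) × (Fin c → K) :=
    (LinearEquiv.prodComm K _ _).toLinearMap ∘ₗ θ'
  have hθ : ∀ x y : C.restrictScalars K,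
      symp (coords β (x : Fin n → E)) (coords β (y : Fin n → E)) + symp (θ x) (θ y) = 0 := by
    intro x y
    rw [← sympForm_apply, hθB]
    exact (congrArg _ (symp_swap (θ' x) (θ' y))).trans (add_neg_cancel _)
  obtain ⟨z, hz, hunit⟩ := exists_phases
    (fun x : C.restrictScalars K => biPauli χ (coords β (x : Fin n → E)) (θ x))
    (fun x y => ⟨_, by
      rw [biPauli_mul, Submodule.coe_add, map_add (coords β), map_add θ]⟩)
    (fun x => conjTranspose_biPauli_mul_self _ _)
    (fun x y => by
      rw [biPauli_mul_comm, hθ, AddChar.map_zero_eq_one, one_smul])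
  refine ⟨θ, _, (LinearEquiv.prodComm K _ _).surjective.comp hθ', fun x => ⟨z x, rfl⟩, hz,
    hunit, ?_⟩
  set S := fun x : C.restrictScalars K =>
    z x • biPauli χ (coords β (x : Fin n → E)) (θ x) with hSdef
  have hS0 : S 0 = 1 := by
    have h2 := hunit 0
    have h3 : S 0 * S 0 = S 0 := (hz 0 0).trans (congrArg S (add_zero 0))
    calc S 0 = (S 0)ᴴ * S 0 * S 0 := by rw [h2, Matrix.one_mul]
      _ = (S 0)ᴴ * S 0 := by rw [Matrix.mul_assoc, h3]
      _ = 1 := h2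
  -- Only the identity has nonzero trace, because `coords` is injective; hence `dim * q^(2k) = q^(n
  -- + c)`.
  have hsum : ∑ x, (S x).trace = (S 0).trace := by
    refine Finset.sum_eq_single 0 (fun x _ hx => ?_) (by simp)
    rw [hSdef, Matrix.trace_smul, trace_biPauli hχ, smul_zero]
    left
    rw [Ne, map_eq_zero_iff _ (coords_injective β)]
    simpa using hx
  have hfinrank : Module.finrank K (C.restrictScalars K) = 2 * Module.finrank E C := by
    rw [← hE, Module.finrank_mul_finrank K E]; rfl
  have h1 := finrank_jointFixed_mul_card (S := S) hz
  rw [hsum, hS0, Matrix.trace_one, ← Nat.card_eq_fintype_card (α := C.restrictScalars K),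
    Module.natCard_eq_pow_finrank (K := K), hfinrank, Nat.card_eq_fintype_card,
    Fintype.card_prod, Fintype.card_fun, Fintype.card_fun, Fintype.card_fin, Fintype.card_fin,
    ← pow_add, ← hκ, pow_add] at h1
  exact Nat.eq_of_mul_eq_mul_right (pow_pos Fintype.card_pos _) (by exact_mod_cast h1)

theorem exists_hermitianConstruction [DecidableEq E] (hE : Module.finrank K E = 2)
    (C : Submodule E (Fin n → E)) {κ δ : ℕ}
    (hc : c + Module.finrank E (hermitianHull K C) = Module.finrank E C)
    (hκ : κ + 2 * Module.finrank E C = n + c)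
    (hδ : IsMinWeight (hermitianDual K C) δ)
    (hx : ∃ x ∈ hermitianDual K C, x ∉ C ∧ hammingNorm x = δ) :
    ∃ Q : Submodule ℂ ((Fin n → K) × (Fin c → K) → ℂ),
      IsEAQECC Q κ δ ∧ IsHermitianConstruction C Q κ ∧ IsPureTo Q δ := by
  have : Module.Finite K E := Module.finite_of_finrank_pos (by omega)
  have : Finite (C.restrictScalars K) := Module.finite_of_finite K
  have := Fintype.ofFinite (C.restrictScalars K)
  obtain ⟨χ, hχ⟩ : ∃ χ : AddChar K ℂ, χ ≠ 1 := by
    obtain ⟨χ, h⟩ := AddChar.exists_apply_ne_zero.2 (one_ne_zero (α := K))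
    exact ⟨χ, AddChar.ne_one_iff.2 ⟨1, h⟩⟩
  let β : Module.Basis (Fin 2) K E := Module.finBasisOfFinrankEq K E hE
  obtain ⟨θ, S, hθ, hSP, hS, hunit, hdim⟩ :=
    exists_stabilizer_representation hE hχ β C hc hκ
  have hvanish : ∀ (v : (Fin n → K) × (Fin n → K)) (w : (Fin c → K) × (Fin c → K))
      (y : C.restrictScalars K), χ (symp (coords β (y : Fin n → E)) v + symp (θ y) w) ≠ 1 →
      ∀ φ ∈ jointFixed S, ∀ ψ ∈ jointFixed S, star φ ⬝ᵥ (biPauli χ v w *ᵥ ψ) = 0 := by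
    intro v w y hy φ hφ ψ hψ
    obtain ⟨z, hz⟩ := hSP y
    exact biPauli_expectation_eq_zero (hz ▸ hunit y) hy (hz ▸ hφ y) (hz ▸ hψ y)
  have hq : ∀ m : ℕ, ((Fintype.card K : ℂ) ^ m) ≠ 0 := fun m =>
    pow_ne_zero _ (Nat.cast_ne_zero.2 Fintype.card_ne_zero)
  have hbob : ∀ B : Matrix (Fin c → K) (Fin c → K) ℂ, ∀ v ∈ jointFixed S, ∀ w ∈ jointFixed S,
      star v ⬝ᵥ (((1 : Matrix (Fin n → K) (Fin n → K) ℂ) ⊗ₖ B) *ᵥ w) =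
        B.trace / (Fintype.card K : ℂ) ^ c * (star v ⬝ᵥ w) := by
    intro B
    refine trace_expectation_of_mem_span (jointFixed S)
      { toFun := fun B => (1 : Matrix (Fin n → K) (Fin n → K) ℂ) ⊗ₖ B
        map_add' := Matrix.kronecker_add _
        map_smul' := fun r B => Matrix.kronecker_smul r _ B } _ _ ?_ (mem_span_pauliSet_univ hχ B)
    rintro _ ⟨a, b, -, rfl⟩ v hv w hw
    change star v ⬝ᵥ ((1 ⊗ₖ pauli χ a b) *ᵥ w) = _
    by_cases hab : (a, b) = 0
    · obtain ⟨rfl, rfl⟩ := Prod.mk_eq_zero.1 hab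
      rw [pauli_zero, Matrix.one_kronecker_one, Matrix.one_mulVec, Matrix.trace_one]
      simp [hq c]
    · rw [trace_pauli hχ hab, zero_div, zero_mul, ← biPauli_zero_left (a, b)]
      obtain ⟨u, hu⟩ : ∃ u, symp (a, b) u ≠ 0 := by
        by_contra! h
        exact hab (eq_zero_of_symp_eq_zero h)
      rw [symp_comm, neg_ne_zero] at hu
      -- `χ` may be trivial on this nonzero symplectic value, so the stabilizer label is rescaled
      -- within `K`.
      obtain ⟨r, hr⟩ := exists_addChar_mul_ne_one hχ hu
      obtain ⟨y, rfl⟩ := hθ u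
      refine hvanish _ _ (r • y) ?_ v hv w hw
      rw [map_smul, symp_smul_left, symp_comm _ 0, symp_zero_left, neg_zero, zero_add]
      exact hr
  have hpure : IsPureTo (jointFixed S) δ := by
    intro T hT A hA
    refine trace_expectation_of_mem_span (jointFixed S)
      { toFun := fun A => A ⊗ₖ (1 : Matrix (Fin c → K) (Fin c → K) ℂ)
        map_add' := fun A B => Matrix.add_kronecker A B _
        map_smul' := fun r A => Matrix.smul_kronecker r A _ } _ _ ?_ (hA.mem_span_pauliSet hχ)
    rintro _ ⟨a, b, hab, rfl⟩ v hv w hw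
    change star v ⬝ᵥ ((pauli χ a b ⊗ₖ 1) *ᵥ w) = _
    obtain ⟨x, hx⟩ := coords_surjective β (a, b)
    by_cases hx0 : x = 0
    · subst hx0
      rw [map_zero, eq_comm, Prod.mk_eq_zero] at hx
      obtain ⟨rfl, rfl⟩ := hx
      rw [pauli_zero, Matrix.one_kronecker_one, Matrix.one_mulVec, Matrix.trace_one]
      simp [hq n]
    · have hab0 : (a, b) ≠ 0 := by
        rw [← hx, Ne, map_eq_zero_iff _ (coords_injective β)]
        exact hx0
      have hwt : hammingNorm x < δ := by
        refine lt_of_le_of_lt (Finset.card_le_card fun i hi => ?_) hT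
        by_contra hiT
        refine (Finset.mem_filter.1 hi).2 ((coords_apply_eq_zero_iff β x i).1 ?_)
        rw [hx]
        exact hab i hiT
      -- Too light to be in the dual, `x` pairs nontrivially with some codeword, whose stabilizer
      -- kills the expectation of this error.
      have hxd : x ∉ hermitianDual K C := fun h => hwt.not_ge (hδ.2 ⟨x, h, hx0, rfl⟩)
      rw [mem_hermitianDual_iff_sympForm hE β] at hxd
      push Not at hxd
      obtain ⟨y, hy, hxy⟩ := hxd
      rw [sympForm_apply, symp_comm, neg_ne_zero] at hxy
      obtain ⟨r, hr⟩ := exists_addChar_mul_ne_one hχ hxy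
      rw [trace_pauli hχ hab0, zero_div, zero_mul, ← biPauli_zero_right (a, b)]
      refine hvanish _ _ (r • (⟨y, hy⟩ : C.restrictScalars K)) ?_ v hv w hw
      rw [Submodule.coe_smul, map_smul, symp_smul_left, symp_comm _ 0, symp_zero_left, neg_zero,
        add_zero, ← hx]
      exact hr
  refine ⟨jointFixed S, ⟨?_, ?_, ?_⟩, ⟨hc, hκ, χ, β, hχ, ?_⟩, hpure⟩
  -- The number of ancillas is `n - κ - c = 2ℓ`, with `ℓ` the hull dimension.
  · exact isEncoded_of_bob_maximally_mixed (a := 2 * Module.finrank E (hermitianHull K C)) _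
      (by omega) hdim hbob
  · left
    obtain ⟨x, hxd, hxC, rfl⟩ := hx
    refine ⟨Finset.univ.filter fun i => x i ≠ 0, rfl, pauli χ (coords β x).1 (coords β x).2,
      supportedOn_pauli fun i hi => ?_, Or.inl ?_⟩
    · rw [coords_apply_eq_zero_iff]
      simpa using hi
    -- `x` in the dual makes its Pauli operator commute with all stabilizers; `x ∉ C` keeps its
    -- products with them traceless.
    · refine not_detects_of_trace_eq_zero hS ?_ (conjTranspose_pauli_mul_self _ _) ?_ ?_
      · rw [hdim]
        exact pow_ne_zero _ Fintype.card_ne_zero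
      · intro y
        obtain ⟨z, hz⟩ := hSP y
        rw [hz, ← biPauli_zero_right, Matrix.smul_mul, biPauli_mul_comm, symp_zero_left,
          ← sympForm_apply, (mem_hermitianDual_iff_sympForm hE β C x).1 hxd y y.2, add_zero,
          AddChar.map_zero_eq_one, one_smul, Matrix.mul_smul]
      · intro y
        obtain ⟨z, hz⟩ := hSP y
        rw [hz, ← biPauli_zero_right, Matrix.mul_smul, biPauli_mul, Matrix.trace_smul,
          Matrix.trace_smul, trace_biPauli hχ, smul_zero, smul_zero]
        left
        rw [← map_add, Ne, map_eq_zero_iff _ (coords_injective β)]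
        intro h
        exact hxC (by rw [eq_neg_of_add_eq_zero_left h]; exact C.neg_mem y.2)
  · rintro d (⟨T, rfl, A, hA, h⟩ | rfl)
    · by_contra! hlt
      have hA' := hpure T hlt A hA
      exact h.elim (fun h => h ⟨_, hA'⟩) (fun h => h.2 hA')
    · obtain ⟨x, -, -, rfl⟩ := hx
      exact (hammingNorm_le_card_fintype.trans (Fintype.card_fin n).le).trans (Nat.le_succ n)
  · intro x hx
    obtain ⟨z, hz⟩ := hSP ⟨x, hx⟩
    refine ⟨z, (θ ⟨x, hx⟩).1, (θ ⟨x, hx⟩).2, fun w hw => ?_⟩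
    have := hw ⟨x, hx⟩
    rw [hz] at this
    exact this

end Construction
end EAQ

theorem mainTheorem2 {K E : Type*} [Field K] [Fintype K] [DecidableEq K]
    [Field E] [DecidableEq E] [Algebra K E] (hE : Module.finrank K E = 2)
    (hq : 2 < Fintype.card K) (n κ δ c ℓ : ℕ)
    (C : Submodule E (Fin n → E))
    (Q : Submodule ℂ ((Fin n → K) × (Fin c → K) → ℂ))
    (hQ : EAQ.IsEAQECC Q κ δ)
    (hCQ : EAQ.IsHermitianConstruction C Q κ)
    (hpure : EAQ.IsMinWeight (EAQ.hermitianDual K C) δ)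
    (hℓ : Module.finrank E (EAQ.hermitianHull K C) = ℓ)
    (i : ℕ) (hi : 1 ≤ i) (hiℓ : i ≤ ℓ) :
    ∃ (C' : Submodule E (Fin n → E))
      (Q' : Submodule ℂ ((Fin n → K) × (Fin (c + i) → K) → ℂ)),
      EAQ.IsEAQECC Q' (κ + i) δ ∧
      EAQ.IsHermitianConstruction C' Q' (κ + i) ∧
      EAQ.IsMinWeight (EAQ.hermitianDual K C') δ ∧
      EAQ.IsPureTo Q' δ := by
  -- The lemma counts `i + 1` scalings, hence `i - 1`; this is where `1 ≤ i` enters.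
  obtain ⟨C', h1, h2, h3, h4⟩ := EAQ.exists_hull_finrank_sub hE hq hpure (i - 1) (by omega)
  have hebits := hCQ.ebits
  have hlogical := hCQ.logical
  obtain ⟨Q', h5, h6, h7⟩ := EAQ.exists_hermitianConstruction (c := c + i) (κ := κ + i) hE C'
    (by omega) (by omega) h3 h4
  exact ⟨C', Q', h5, h6, h3, h7⟩
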